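/- Let $q\in L^1_{loc}(\mathbb R)$ be real valued and even, such that $\tau_q(y)=-y''-qy$ is in the limit circle case at $+\infty$ and at $-\infty$ (for every $\lambda\in\mathbb C$ all solutions of $\tau_q y=\lambda y$ are square integrable near $\pm\infty$). Let $\mathcal D_{\max}=\{y\in L^2(\mathbb R): y,y'\in AC_{loc}(\mathbb R),\ \tau_q y\in L^2(\mathbb R)\}$, let $A_{\max}y=\tau_q y$ on $\mathcal D_{\max}$, and let $A$ be the closure of the restriction of $A_{\max}$ to the functions in $\mathcal D_{\max}$ with compact support, so that $A^*=A_{\max}$. Let $(\mathcal Pf)(x)=f(-x)$ and, for an operator $T$ in $L^2(\mathbb R)$, $T^+=\mathcal P T^*\mathcal P$. Put $[f,g]_x=\overline{f(x)}g'(x)-\overline{f'(x)}g(x)$ and $[f,g]_{\pm\infty}=\lim_{x\to\pm\infty}[f,g]_x$. Let $w_1,w_2$ be real valued solutions of $\tau_q y=0$, $w_1$ odd and $w_2$ even, with $[w_1,w_2]_{-\infty}=[w_1,w_2]_{\infty}=1$, and for $f\in\mathcal D_{\max}$ and $j=1,2$ put $\alpha_j(f)=[w_j,f]_{-\infty}$,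 $\beta_j(f)=[w_j,f]_{\infty}$. A two-dimensional bi-extension of $A$ is a closed operator $\widetilde A$ with $A\subset\widetilde A\subset A^*$ and $\dim(\operatorname{dom}\widetilde A/\operatorname{dom}A)=2$. The domain of every two-dimensional bi-extension of $A$ has one of the forms in (1), (2), (3) below, where in (1) one may take $\alpha,\beta\in[0,2\pi)$. For every restriction $\widetilde A$ of $A_{\max}$ one has $\operatorname{dom}\widetilde A^+=\mathcal P\operatorname{dom}\widetilde A^*$. Moreover, for every restriction $\widetilde A$ of $A_{\max}$: (1) If, with $\xi,\eta\in\mathbb C$, $|\xi|=|\eta|=1$ and $\alpha,\beta\in\mathbb R$, $$\operatorname{dom}\widetilde A=\{f\in\mathcal D_{\max}:\ \alpha_1(f)\,\xi\cos\alpha-\alpha_2(f)\sin\alpha=0,\ \beta_1(f)\,\eta\cos\beta-\beta_2(f)\sin\beta=0\},$$ then $$\operatorname{dom}\widetilde A^*=\{g\in\mathcal D_{\max}:\ \alpha_1(g)\cos\alpha-\alpha_2(g)\,\xi\sin\alpha=0,\ \beta_1(g)\cos\beta-\beta_2(g)\,\eta\sin\beta=0\},$$ $$\operatorname{dom}\widetilde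 A^+=\{g\in\mathcal D_{\max}:\ \alpha_1(g)\cos\beta+\alpha_2(g)\,\eta\sin\beta=0,\ \beta_1(g)\cos\alpha+\beta_2(g)\,\xi\sin\alpha=0\}.$$ (2) If, with $a,b,c,d\in\mathbb C$, $$\operatorname{dom}\widetilde A=\Big\{f\in\mathcal D_{\max}:\ \begin{pmatrix}\beta_1(f)\\ \beta_2(f)\end{pmatrix}=\begin{bmatrix}a&b\\c&d\end{bmatrix}\begin{pmatrix}\alpha_1(f)\\ \alpha_2(f)\end{pmatrix}\Big\},$$ then $$\operatorname{dom}\widetilde A^*=\Big\{g\in\mathcal D_{\max}:\ \begin{pmatrix}\alpha_1(g)\\ \alpha_2(g)\end{pmatrix}=\begin{bmatrix}\overline d&-\overline b\\-\overline c&\overline a\end{bmatrix}\begin{pmatrix}\beta_1(g)\\ \beta_2(g)\end{pmatrix}\Big\},$$ $$\operatorname{dom}\widetilde A^+=\Big\{g\in\mathcal D_{\max}:\ \begin{pmatrix}\beta_1(g)\\ \beta_2(g)\end{pmatrix}=\begin{bmatrix}\overline d&\overline b\\ \overline c&\overline a\end{bmatrix}\begin{pmatrix}\alpha_1(g)\\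 \alpha_2(g)\end{pmatrix}\Big\}.$$ (3) If, with $a,b,c,d\in\mathbb C$, $$\operatorname{dom}\widetilde A=\Big\{f\in\mathcal D_{\max}:\ \begin{pmatrix}\alpha_1(f)\\ \alpha_2(f)\end{pmatrix}=\begin{bmatrix}a&b\\c&d\end{bmatrix}\begin{pmatrix}\beta_1(f)\\ \beta_2(f)\end{pmatrix}\Big\},$$ then $$\operatorname{dom}\widetilde A^*=\Big\{g\in\mathcal D_{\max}:\ \begin{pmatrix}\beta_1(g)\\ \beta_2(g)\end{pmatrix}=\begin{bmatrix}\overline d&-\overline b\\-\overline c&\overline a\end{bmatrix}\begin{pmatrix}\alpha_1(g)\\ \alpha_2(g)\end{pmatrix}\Big\},$$ $$\operatorname{dom}\widetilde A^+=\Big\{g\in\mathcal D_{\max}:\ \begin{pmatrix}\alpha_1(g)\\ \alpha_2(g)\end{pmatrix}=\begin{bmatrix}\overline d&\overline b\\ \overline c&\overline a\end{bmatrix}\begin{pmatrix}\beta_1(g)\\ \beta_2(g)\end{pmatrix}\Big\}.$$ -/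

import Mathlib

open MeasureTheory Filter Topology
open scoped ComplexConjugate ComplexInnerProductSpace

noncomputable section

namespace LimitCircle

/-- The Hilbert space `L²(ℝ)` of complex valued functions. -/
abbrev L2 : Type := Lp ℂ 2 (volume : Measure ℝ)

/-- `AC_loc(ℝ)`: absolute continuity on every compact interval. -/
def LocAC (y : ℝ → ℂ) : Prop := ∀ a b : ℝ, AbsolutelyContinuousOnInterval y a b

/-- `y, y' ∈ AC_loc(ℝ)`. -/
structure Regular (y : ℝ → ℂ) : Prop where
  diff : Differentiable ℝ y
  ac : LocAC y
  ac_deriv : LocAC (deriv y)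

/-- The differential expression `τ_q y = -y'' - q y` (meaningful almost everywhere for regular
`y`). -/
def tau (q : ℝ → ℝ) (y : ℝ → ℂ) (x : ℝ) : ℂ := -deriv (deriv y) x - (q x : ℂ) * y x

/-- `y` is a solution of `τ_q y = lam y` on the real line. -/
structure IsSolution (q : ℝ → ℝ) (lam : ℂ) (y : ℝ → ℂ) : Prop where
  regular : Regular y
  eqn : ∀ᵐ x : ℝ, tau q y x = lam * y x

/-- Limit circle case at `+∞`: all solutions are square integrable near `+∞`. -/
def IsLimitCircleTop (q : ℝ → ℝ) : Prop :=
  ∀ (lam : ℂ) (y : ℝ → ℂ), IsSolution q lam y →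
    ∃ a : ℝ, MemLp y 2 (volume.restrict (Set.Ioi a))

/-- Limit circle case at `-∞`: all solutions are square integrable near `-∞`. -/
def IsLimitCircleBot (q : ℝ → ℝ) : Prop :=
  ∀ (lam : ℂ) (y : ℝ → ℂ), IsSolution q lam y →
    ∃ a : ℝ, MemLp y 2 (volume.restrict (Set.Iio a))

/-! ### The maximal and minimal operators -/

theorem LocAC.ae_differentiableAt {y : ℝ → ℂ} (h : LocAC y) :
    ∀ᵐ x : ℝ, DifferentiableAt ℝ y x := by
  have hv : LocallyBoundedVariationOn y Set.univ := by
    intro a b _ _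
    refine BoundedVariationOn.mono ((h a b).boundedVariationOn) ?_
    rw [Set.univ_inter]
    exact Set.Icc_subset_uIcc
  exact hv.ae_differentiableAt

theorem Regular.zero : Regular 0 := by
  have h0 : LocAC 0 := by
    intro a b
    have : LipschitzOnWith 0 (0 : ℝ → ℂ) (Set.uIcc a b) :=
      (LipschitzWith.const (0 : ℂ)).lipschitzOnWith
    exact this.absolutelyContinuousOnInterval
  refine ⟨differentiable_const (0 : ℂ), h0, ?_⟩
  have : deriv (0 : ℝ → ℂ) = 0 := by ext x; simp
  rw [this]
  exact h0

theorem Regular.add {y z : ℝ → ℂ} (hy : Regular y) (hz : Regular z) : Regular (y + z) := by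
  refine ⟨hy.diff.add hz.diff, fun a b => (hy.ac a b).add (hz.ac a b), ?_⟩
  have : deriv (y + z) = deriv y + deriv z := by
    ext x; exact deriv_add (hy.diff x) (hz.diff x)
  rw [this]
  exact fun a b => (hy.ac_deriv a b).add (hz.ac_deriv a b)

theorem Regular.smul {y : ℝ → ℂ} (c : ℂ) (hy : Regular y) : Regular (c • y) := by
  refine ⟨hy.diff.const_smul c, fun a b => (hy.ac a b).const_smul c, ?_⟩
  have : deriv (c • y) = c • deriv y := by
    ext x; exact deriv_const_smul c (hy.diff x)
  rw [this]
  exact fun a b => (hy.ac_deriv a b).const_smul c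

theorem tau_add (q : ℝ → ℝ) {y z : ℝ → ℂ} (hy : Regular y) (hz : Regular z) :
    tau q (y + z) =ᵐ[volume] tau q y + tau q z := by
  have h1 : deriv (y + z) = deriv y + deriv z := by
    ext x; exact deriv_add (hy.diff x) (hz.diff x)
  filter_upwards [hy.ac_deriv.ae_differentiableAt, hz.ac_deriv.ae_differentiableAt] with x hx hx'
  simp only [tau, h1, Pi.add_apply, deriv_add hx hx']
  ring

theorem tau_smul (q : ℝ → ℝ) (c : ℂ) {y : ℝ → ℂ} (hy : Regular y) :
    tau q (c • y) =ᵐ[volume] c • tau q y := by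
  have h1 : deriv (c • y) = c • deriv y := by
    ext x; exact deriv_const_smul c (hy.diff x)
  filter_upwards [hy.ac_deriv.ae_differentiableAt] with x hx
  simp only [tau, h1, Pi.smul_apply, deriv_const_smul c hx, smul_eq_mul]
  ring

theorem tau_zero (q : ℝ → ℝ) : tau q 0 = 0 := by
  have h : deriv (0 : ℝ → ℂ) = 0 := by ext x; simp
  ext x
  simp [tau, h]

/-- The maximal domain `{y ∈ L²(ℝ) : y, y' ∈ AC_loc(ℝ), τ_q y ∈ L²(ℝ)}`, as a space of
(continuously differentiable) functions. -/
def maxFun (q : ℝ → ℝ) : Submodule ℂ (ℝ → ℂ) where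
  carrier := {y | Regular y ∧ MemLp y 2 volume ∧ MemLp (tau q y) 2 volume}
  zero_mem' := ⟨Regular.zero, MemLp.zero, by rw [tau_zero]; exact MemLp.zero⟩
  add_mem' := fun {_ _} hy hz => ⟨hy.1.add hz.1, hy.2.1.add hz.2.1,
    (hy.2.2.add hz.2.2).ae_eq (tau_add q hy.1 hz.1).symm⟩
  smul_mem' := fun c _ hy => ⟨hy.1.smul c, hy.2.1.const_smul c,
    (hy.2.2.const_smul c).ae_eq (tau_smul q c hy.1).symm⟩

/-- The class in `L²(ℝ)` of a function of the maximal domain. -/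
def toL2 (q : ℝ → ℝ) : maxFun q →ₗ[ℂ] L2 where
  toFun y := y.2.2.1.toLp y.1
  map_add' _ _ := rfl
  map_smul' _ _ := rfl

/-- The class of `τ_q y` in `L²(ℝ)`. -/
def tauL2 (q : ℝ → ℝ) : maxFun q →ₗ[ℂ] L2 where
  toFun y := y.2.2.2.toLp (tau q y.1)
  map_add' y z := by
    rw [← MemLp.toLp_add, MemLp.toLp_eq_toLp_iff]
    exact tau_add q y.2.1 z.2.1
  map_smul' c y := by
    rw [RingHom.id_apply, ← MemLp.toLp_const_smul, MemLp.toLp_eq_toLp_iff]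
    exact tau_smul q c y.2.1

theorem toL2_injective (q : ℝ → ℝ) : Function.Injective (toL2 q) := by
  intro y z h
  have h' : (y : ℝ → ℂ) =ᵐ[volume] z :=
    (MemLp.toLp_eq_toLp_iff y.2.2.1 z.2.2.1).1 h
  exact Subtype.ext
    (Continuous.ae_eq_iff_eq volume y.2.1.diff.continuous z.2.1.diff.continuous |>.1 h')

/-- The maximal operator `A_max y = τ_q y` in `L²(ℝ)`. -/
def maxOp (q : ℝ → ℝ) : L2 →ₗ.[ℂ] L2 where
  domain := LinearMap.range (toL2 q)
  toFun := (tauL2 q).comp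
    (LinearEquiv.ofInjective (toL2 q) (toL2_injective q)).symm.toLinearMap

/-- The domain of the pre-minimal operator: functions of the maximal domain with compact
support. -/
def preMinDomain (q : ℝ → ℝ) : Submodule ℂ L2 where
  carrier := {f | ∃ y : maxFun q, HasCompactSupport (y : ℝ → ℂ) ∧ toL2 q y = f}
  zero_mem' := ⟨0, HasCompactSupport.zero, map_zero _⟩
  add_mem' := by
    rintro _ _ ⟨y, hy, rfl⟩ ⟨z, hz, rfl⟩
    exact ⟨y + z, HasCompactSupport.add hy hz, map_add _ _ _⟩
  smul_mem' := by
    rintro c _ ⟨y, hy, rfl⟩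
    exact ⟨c • y, HasCompactSupport.smul_left (f := fun _ : ℝ => c) hy, map_smul _ _ _⟩

/-- The minimal operator `A`: the closure of the restriction of the maximal operator to the
functions with compact support. -/
def minOp (q : ℝ → ℝ) : L2 →ₗ.[ℂ] L2 := ((maxOp q).domRestrict (preMinDomain q)).closure

/-! ### Bi-extensions and the Krein space adjoint -/

/-- A closed operator `T` with `A ⊆ T ⊆ A*` is a bi-extension of `A`. -/
structure IsBiExtension (A T : L2 →ₗ.[ℂ] L2) : Prop where
  closed : T.IsClosed
  le : A ≤ T
  le_adjoint : T ≤ A.adjoint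

/-- `T` is a two-dimensional bi-extension of `A`, i.e. `dim (dom T / dom A) = 2`. -/
structure IsTwoDimBiExtension (A T : L2 →ₗ.[ℂ] L2) : Prop extends IsBiExtension A T where
  finrank_eq : Module.finrank ℂ (T.domain ⧸ A.domain.submoduleOf T.domain) = 2

/-- Parity `(P f)(x) = f(-x)` on `L²(ℝ)`. -/
def parity : L2 →ₗ[ℂ] L2 :=
  (Lp.compMeasurePreservingₗᵢ ℂ (Neg.neg : ℝ → ℝ)
    (Measure.measurePreserving_neg (volume : Measure ℝ))).toLinearMap

/-- The adjoint `T⁺ = P T* P` with respect to the Krein space inner product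
`[f, g] = ∫ f(x) conj (g(-x)) dx`, whose fundamental symmetry is the parity `P`. -/
def kreinAdjoint (T : L2 →ₗ.[ℂ] L2) : L2 →ₗ.[ℂ] L2 where
  domain := T.adjoint.domain.comap parity
  toFun := parity ∘ₗ T.adjoint.toFun ∘ₗ
    parity.restrict (p := T.adjoint.domain.comap parity) (q := T.adjoint.domain) (fun _ hx => hx)

/-! ### Boundary values -/

/-- `[f, g]_x = conj (f x) g'(x) - conj (f'(x)) g(x)`. -/
def bracket (f g : ℝ → ℂ) (x : ℝ) : ℂ := conj (f x) * deriv g x - conj (deriv f x) * g x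

/-- `[w, y]_{-∞}`. -/
def bvBot (w y : ℝ → ℂ) : ℂ := limUnder atBot (bracket w y)

/-- `[w, y]_{+∞}`. -/
def bvTop (w y : ℝ → ℂ) : ℂ := limUnder atTop (bracket w y)

/-- `w₁` and `w₂` are real valued solutions of `τ_q y = 0`, `w₁` odd and `w₂` even, with
`[w₁, w₂]_{-∞} = [w₁, w₂]_{+∞} = 1`. (In the limit circle case they lie in the maximal domain,
and `[wⱼ, wⱼ]` vanishes because `wⱼ` is real.) -/
structure IsReferencePair (q : ℝ → ℝ) (w₁ w₂ : ℝ → ℂ) : Prop where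
  sol₁ : IsSolution q 0 w₁
  sol₂ : IsSolution q 0 w₂
  real₁ : ∀ x, (w₁ x).im = 0
  real₂ : ∀ x, (w₂ x).im = 0
  odd₁ : ∀ x, w₁ (-x) = -w₁ x
  even₂ : ∀ x, w₂ (-x) = w₂ x
  bracket_bot : Tendsto (bracket w₁ w₂) atBot (𝓝 1)
  bracket_top : Tendsto (bracket w₁ w₂) atTop (𝓝 1)

/-- The elements of the maximal domain, as a subset of `L²(ℝ)`, which satisfy the boundary
condition `C`. The condition is given in terms of `(α₁, α₂)` and `(β₁, β₂)` where
`αⱼ = [wⱼ, y]_{-∞}` and `βⱼ = [wⱼ, y]_{+∞}`. -/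
def bcDomain (q : ℝ → ℝ) (w₁ w₂ : ℝ → ℂ) (C : (Fin 2 → ℂ) → (Fin 2 → ℂ) → Prop) : Set L2 :=
  {f | ∃ y : maxFun q, toL2 q y = f ∧
    C ![bvBot w₁ y, bvBot w₂ y] ![bvTop w₁ y, bvTop w₂ y]}

/-- Separated boundary conditions `a α₁ + b α₂ = 0`, `c β₁ + d β₂ = 0`. -/
def separatedDomain (q : ℝ → ℝ) (w₁ w₂ : ℝ → ℂ) (a b c d : ℂ) : Set L2 :=
  bcDomain q w₁ w₂ fun va vb => a * va 0 + b * va 1 = 0 ∧ c * vb 0 + d * vb 1 = 0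

/-- Mixed boundary conditions `(α₁, α₂)ᵀ = M (β₁, β₂)ᵀ`. -/
def alphaOfBetaDomain (q : ℝ → ℝ) (w₁ w₂ : ℝ → ℂ) (M : Matrix (Fin 2) (Fin 2) ℂ) : Set L2 :=
  bcDomain q w₁ w₂ fun va vb => va = M.mulVec vb

/-- Mixed boundary conditions `(β₁, β₂)ᵀ = M (α₁, α₂)ᵀ`. -/
def betaOfAlphaDomain (q : ℝ → ℝ) (w₁ w₂ : ℝ → ℂ) (M : Matrix (Fin 2) (Fin 2) ℂ) : Set L2 :=
  bcDomain q w₁ w₂ fun va vb => vb = M.mulVec va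

/-- The domain given by the normalized separated boundary conditions
`α₁ ξ cos a - α₂ sin a = 0`, `β₁ η cos b - β₂ sin b = 0`. -/
def normalizedSeparatedDomain (q : ℝ → ℝ) (w₁ w₂ : ℝ → ℂ) (ξ η : ℂ) (a b : ℝ) : Set L2 :=
  separatedDomain q w₁ w₂ (ξ * Real.cos a) (-Real.sin a) (η * Real.cos b) (-Real.sin b)

end LimitCircle

end

noncomputable section

namespace LimitCircle

/-! ### Locally absolutely continuous functions -/

/-! Everything is reduced to linear algebra in the space ℂ² × ℂ² of boundary values Γf = (α(f),
β(f)).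

The limit circle hypothesis puts `w₁`, `w₂` into the maximal domain. Since they are real with
Wronskian 1, any bracket [f, g] is a skew form in the brackets with `w₁` and `w₂`
(`IsReferencePair.bracket_eq`). Integrating Lagrange's identity therefore gives Green's formula
(`IsMaxPair.green`): ⟨τf, g⟩ - ⟨f, τg⟩ = ω(β(f), β(g)) - ω(α(f), α(g)), where ω is the nondegenerate
form `symp`. The map Γ is onto, as shown by `w₁`, `w₂` and their cut-offs (`boundary_surjective`).

The analytic core is that weak solutions of τg = h are strong (`IsMaxPair.exists_of_weak`), proved
by variation of parameters and testing against functions of compact support. It yields density, A* =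
A_max, and dom A = ker Γ.

Hence a two-dimensional bi-extension has domain Γ⁻¹(V) for a plane V. If Γ⁻¹(C) is the domain of a
restriction, then its adjoint has domain Γ⁻¹(C'), where C' is the complement of C for the form in
Green's formula. Parity exchanges the two ends and changes the sign of the second boundary value at
each end, which gives the Krein adjoint. What is left is to sort the planes V (product of two lines,
or graph over one factor) and to compute complements. -/

theorem LocAC.continuous {f : ℝ → ℂ} (hf : LocAC f) : Continuous f := by
  rw [continuous_iff_continuousAt]
  intro x
  exact ((hf (x - 1) (x + 1)).continuousOn).continuousAt
    (by rw [Set.uIcc_of_le (by linarith)]; exact Icc_mem_nhds (by linarith) (by linarith))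

theorem LocAC.of_contDiff {f : ℝ → ℂ} (hf : ContDiff ℝ 1 f) : LocAC f :=
  fun _ _ => hf.contDiffOn.absolutelyContinuousOnInterval

theorem LocAC.add {f g : ℝ → ℂ} (hf : LocAC f) (hg : LocAC g) : LocAC (fun x => f x + g x) :=
  fun a b => (hf a b).add (hg a b)

theorem LocAC.sub {f g : ℝ → ℂ} (hf : LocAC f) (hg : LocAC g) : LocAC (fun x => f x - g x) :=
  fun a b => (hf a b).sub (hg a b)

theorem LocAC.mul {f g : ℝ → ℂ} (hf : LocAC f) (hg : LocAC g) : LocAC (fun x => f x * g x) :=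
  fun a b => (hf a b).smul (hg a b)

/-- The sums that define absolute continuity of `g` are dominated termwise by those of `f`. -/
theorem LocAC.of_dist_le {f : ℝ → ℂ} {g : ℝ → ℂ} (hf : LocAC f)
    (h : ∀ x y, dist (g x) (g y) ≤ dist (f x) (f y)) : LocAC g := by
  intro a b
  refine squeeze_zero (fun t => Finset.sum_nonneg fun i _ => dist_nonneg) (fun t => ?_) (hf a b)
  exact Finset.sum_le_sum fun i _ => h _ _

theorem LocAC.conj {f : ℝ → ℂ} (hf : LocAC f) : LocAC (fun x => conj (f x)) :=
  hf.of_dist_le fun _ _ => (Complex.dist_conj_conj _ _).le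

theorem LocAC.comp_neg {f : ℝ → ℂ} (hf : LocAC f) : LocAC (fun x => f (-x)) := by
  intro a b
  have h := (absolutelyContinuousOnInterval_iff f (-a) (-b)).1 (hf (-a) (-b))
  rw [absolutelyContinuousOnInterval_iff]
  intro ε hε
  obtain ⟨δ, hδ, H⟩ := h ε hε
  refine ⟨δ, hδ, fun E hE hs => ?_⟩
  -- The reflected family of intervals is again disjoint and has the same total length.
  refine H (E.1, fun i => (-(E.2 i).1, -(E.2 i).2)) ?_ ?_
  · simp only [AbsolutelyContinuousOnInterval.disjWithin, Set.mem_ofPred_eq] at hE ⊢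
    refine ⟨fun i hi => ?_, ?_⟩
    · have := hE.1 i hi
      simp only [Set.mem_uIcc] at this ⊢
      constructor
      · rcases this.1 with h | h
        · right; constructor <;> linarith
        · left; constructor <;> linarith
      · rcases this.2 with h | h
        · right; constructor <;> linarith
        · left; constructor <;> linarith
    · intro i hi j hj hij
      have := hE.2 hi hj hij
      simp only [Function.onFun, Set.uIoc, Set.Ioc_disjoint_Ioc, min_neg_neg, max_neg_neg,
        neg_le_neg_iff] at this ⊢
      exact this
  · simpa [dist_neg_neg] using hs

/-! ### Locally integrable functions and their primitives -/

theorem _root_.MeasureTheory.LocallyIntegrable.intervalIntegrable' {E : Type*}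
    [NormedAddCommGroup E] {f : ℝ → E} (hf : LocallyIntegrable f volume) (a b : ℝ) :
    IntervalIntegrable f volume a b :=
  intervalIntegrable_iff.mpr
    ((hf.integrableOn_isCompact isCompact_uIcc).mono_set Set.uIoc_subset_uIcc)

theorem _root_.MeasureTheory.LocallyIntegrable.mul_continuous' {f g : ℝ → ℂ}
    (hf : LocallyIntegrable f volume) (hg : Continuous g) :
    LocallyIntegrable (fun x => f x * g x) volume := by
  rw [← locallyIntegrableOn_univ] at hf ⊢
  exact hf.mul_continuousOn hg.continuousOn isOpen_univ.isLocallyClosed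

theorem _root_.MeasureTheory.LocallyIntegrable.conj' {f : ℝ → ℂ}
    (hf : LocallyIntegrable f volume) : LocallyIntegrable (fun x => conj (f x)) volume :=
  hf.mono (Complex.continuous_conj.comp_aestronglyMeasurable hf.aestronglyMeasurable)
    (ae_of_all _ fun x => by simp)

theorem intervalIntegrable_ofReal {f : ℝ → ℝ} {a b : ℝ} (hf : IntervalIntegrable f volume a b) :
    IntervalIntegrable (fun x => (f x : ℂ)) volume a b :=
  ⟨hf.1.ofReal, hf.2.ofReal⟩

theorem LocAC.ofReal {f : ℝ → ℝ} (hf : ∀ a b, AbsolutelyContinuousOnInterval f a b) :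
    LocAC (fun x => (f x : ℂ)) := by
  intro a b
  refine squeeze_zero (fun t => Finset.sum_nonneg fun i _ => dist_nonneg) (fun t => ?_) (hf a b)
  refine Finset.sum_le_sum fun i _ => ?_
  rw [Complex.dist_eq, ← Complex.ofReal_sub, Complex.norm_real, Real.dist_eq, Real.norm_eq_abs]

theorem locAC_integral {f : ℝ → ℂ} (hf : LocallyIntegrable f volume) (c : ℝ) :
    LocAC (fun x => ∫ t in c..x, f t) := by
  have hre : LocallyIntegrable (fun x => (f x).re) volume := fun x => by
    obtain ⟨s, hs, h⟩ := hf x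
    exact ⟨s, hs, h.re⟩
  have him : LocallyIntegrable (fun x => (f x).im) volume := fun x => by
    obtain ⟨s, hs, h⟩ := hf x
    exact ⟨s, hs, h.im⟩
  have key : ∀ g : ℝ → ℝ, LocallyIntegrable g volume → ∀ a b,
      AbsolutelyContinuousOnInterval (fun x => ∫ t in c..x, g t) a b := by
    intro g hg a b
    refine (IntervalIntegrable.absolutelyContinuousOnInterval_intervalIntegral
      -- The base point `c` may lie outside the interval, so the interval is enlarged to contain it.
      (a := min c (min a b)) (b := max c (max a b)) (hg.intervalIntegrable' _ _) ?_).mono ?_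
    · rw [Set.uIcc_of_le (by simp)]; simp
    · rw [Set.uIcc_of_le (a := min c _) ((min_le_left _ _).trans (le_max_left _ _)), Set.uIcc]
      exact Set.Icc_subset_Icc (min_le_right _ _) (le_max_right _ _)
  have h := (LocAC.ofReal (key _ hre)).add
    ((LocAC.of_contDiff (contDiff_const (c := Complex.I))).mul (LocAC.ofReal (key _ him)))
  refine h.of_dist_le fun x y => le_of_eq ?_
  have : ∀ x, ∫ t in c..x, f t = ((∫ t in c..x, (f t).re : ℝ) : ℂ) +
      Complex.I * ((∫ t in c..x, (f t).im : ℝ) : ℂ) := by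
    intro x
    rw [← intervalIntegral.integral_ofReal, ← intervalIntegral.integral_ofReal,
      ← intervalIntegral.integral_const_mul, ← intervalIntegral.integral_add]
    · refine intervalIntegral.integral_congr fun t _ => ?_
      simp only [mul_comm Complex.I, Complex.re_add_im]
    · exact intervalIntegrable_ofReal (hre.intervalIntegrable' _ _)
    · exact (intervalIntegrable_ofReal (him.intervalIntegrable' _ _)).const_mul _
  rw [this, this]

theorem LocAC.eq_add_of_ae_hasDerivAt_zero {f : ℝ → ℂ} (hf : LocAC f)
    (h : ∀ᵐ x, HasDerivAt f 0 x) (x y : ℝ) : f x = f y := by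
  obtain ⟨C, hC⟩ := (hf x y).const_of_ae_hasDerivAt_zero (h.mono fun t ht _ => ht)
  rw [hC x Set.left_mem_uIcc, hC y Set.right_mem_uIcc]

theorem LocAC.integral_eq_sub {F f : ℝ → ℂ} (hF : LocAC F) (hf : LocallyIntegrable f volume)
    (h : ∀ᵐ x, HasDerivAt F (f x) x) (a b : ℝ) : ∫ t in a..b, f t = F b - F a := by
  have h1 := (hF.sub (locAC_integral hf a)).eq_add_of_ae_hasDerivAt_zero (by
    filter_upwards [h, LocallyIntegrable.ae_hasDerivAt_integral hf] with x hx hx'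
    exact (hx.sub (hx' a)).congr_deriv (sub_self _)) b a
  simp only [intervalIntegral.integral_same, sub_zero] at h1
  rw [← h1]; ring

/-- `F` is a primitive of its almost everywhere derivative; when that derivative is continuous, the
fundamental theorem of calculus holds at every point. -/
theorem LocAC.hasDerivAt_of_ae {F f : ℝ → ℂ} (hF : LocAC F) (hf : Continuous f)
    (h : ∀ᵐ x, HasDerivAt F (f x) x) (x : ℝ) : HasDerivAt F (f x) x := by
  have h1 : F = fun x => F 0 + ∫ t in (0 : ℝ)..x, f t := by
    ext y
    rw [hF.integral_eq_sub hf.locallyIntegrable h]; ring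
  rw [h1]
  exact (hf.integral_hasStrictDerivAt 0 x).hasDerivAt.const_add _

theorem Regular.of_hasDerivAt {y y' : ℝ → ℂ} (h : ∀ x, HasDerivAt y (y' x) x) (h' : LocAC y') :
    Regular y := by
  have hd : deriv y = y' := funext fun x => (h x).deriv
  refine ⟨fun x => (h x).differentiableAt, LocAC.of_contDiff ?_, hd ▸ h'⟩
  rw [contDiff_one_iff_deriv]
  exact ⟨fun x => (h x).differentiableAt, hd ▸ h'.continuous⟩


theorem Regular.deriv_continuous {y : ℝ → ℂ} (hy : Regular y) : Continuous (deriv y) :=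
  hy.ac_deriv.continuous

theorem Regular.continuous {y : ℝ → ℂ} (hy : Regular y) : Continuous y := hy.diff.continuous

theorem Regular.ae_hasDerivAt_deriv {y : ℝ → ℂ} (hy : Regular y) (q : ℝ → ℝ) :
    ∀ᵐ x, HasDerivAt (deriv y) (-tau q y x - (q x : ℂ) * y x) x := by
  filter_upwards [hy.ac_deriv.ae_differentiableAt] with x hx
  refine hx.hasDerivAt.congr_deriv ?_
  simp only [tau]; ring

theorem tau_ae_eq {q : ℝ → ℝ} {y y' f : ℝ → ℂ} (h : ∀ x, HasDerivAt y (y' x) x)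
    (h' : ∀ᵐ x, HasDerivAt y' (-f x - (q x : ℂ) * y x) x) : tau q y =ᵐ[volume] f := by
  have hd : deriv y = y' := funext fun x => (h x).deriv
  filter_upwards [h'] with x hx
  simp only [tau, hd, hx.deriv]; ring

/-! ### The bracket -/

theorem Regular.bracket_locAC {f g : ℝ → ℂ} (hf : Regular f) (hg : Regular g) :
    LocAC (bracket f g) :=
  (hf.ac.conj.mul hg.ac_deriv).sub (hf.ac_deriv.conj.mul hg.ac)

/-- Lagrange's identity: the products of first derivatives cancel, and so do the potential terms
because `q` is real. -/
theorem Regular.ae_hasDerivAt_bracket {f g : ℝ → ℂ} (hf : Regular f) (hg : Regular g)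
    (q : ℝ → ℝ) : ∀ᵐ x, HasDerivAt (bracket f g)
      (conj (tau q f x) * g x - conj (f x) * tau q g x) x := by
  filter_upwards [hf.ae_hasDerivAt_deriv q, hg.ae_hasDerivAt_deriv q] with x h1 h2
  have := (((hf.diff x).hasDerivAt.star).mul h2).sub (h1.star.mul (hg.diff x).hasDerivAt)
  refine this.congr_deriv ?_
  simp only [Complex.star_def, map_sub, map_neg, map_mul, Complex.conj_ofReal]
  ring

theorem Regular.integral_bracket {f g : ℝ → ℂ} (hf : Regular f) (hg : Regular g) {q : ℝ → ℝ}
    (hf' : LocallyIntegrable (tau q f) volume) (hg' : LocallyIntegrable (tau q g) volume)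
    (a b : ℝ) : ∫ x in a..b, (conj (tau q f x) * g x - conj (f x) * tau q g x) =
      bracket f g b - bracket f g a := by
  refine (hf.bracket_locAC hg).integral_eq_sub ?_ (hf.ae_hasDerivAt_bracket hg q) a b
  refine (hf'.conj'.mul_continuous' hg.continuous).sub ?_
  simpa only [mul_comm, Function.comp_apply] using
    hg'.mul_continuous' (Complex.continuous_conj.comp hf.continuous)

theorem bracket_add_right {w y z : ℝ → ℂ} (hy : Regular y) (hz : Regular z) (x : ℝ) :
    bracket w (y + z) x = bracket w y x + bracket w z x := by
  simp only [bracket, deriv_add (hy.diff x) (hz.diff x), Pi.add_apply]; ring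

theorem bracket_smul_right {w y : ℝ → ℂ} (c : ℂ) (hy : Regular y) (x : ℝ) :
    bracket w (c • y) x = c * bracket w y x := by
  simp only [bracket, deriv_const_smul c (hy.diff x), Pi.smul_apply, smul_eq_mul]; ring

section ReferencePair

variable {q : ℝ → ℝ} {w₁ w₂ : ℝ → ℂ}

theorem conj_deriv_of_im_eq_zero {w : ℝ → ℂ} (hw : Differentiable ℝ w) (h : ∀ x, (w x).im = 0) (x : ℝ) :
    conj (deriv w x) = deriv w x := by
  have h1 := (hw x).hasDerivAt.star
  have h2 : (fun x => star (w x)) = w := funext fun x => Complex.conj_eq_iff_im.2 (h x)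
  exact (h2 ▸ h1).deriv.symm

theorem IsReferencePair.conj₁ (hw : IsReferencePair q w₁ w₂) (x : ℝ) : conj (w₁ x) = w₁ x :=
  Complex.conj_eq_iff_im.2 (hw.real₁ x)

theorem IsReferencePair.conj₂ (hw : IsReferencePair q w₁ w₂) (x : ℝ) : conj (w₂ x) = w₂ x :=
  Complex.conj_eq_iff_im.2 (hw.real₂ x)

theorem IsReferencePair.conj_deriv₁ (hw : IsReferencePair q w₁ w₂) (x : ℝ) :
    conj (deriv w₁ x) = deriv w₁ x :=
  conj_deriv_of_im_eq_zero hw.sol₁.regular.diff hw.real₁ x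

theorem IsReferencePair.conj_deriv₂ (hw : IsReferencePair q w₁ w₂) (x : ℝ) :
    conj (deriv w₂ x) = deriv w₂ x :=
  conj_deriv_of_im_eq_zero hw.sol₂.regular.diff hw.real₂ x

theorem IsReferencePair.bracket_left₁ (hw : IsReferencePair q w₁ w₂) (f : ℝ → ℂ) (x : ℝ) :
    bracket w₁ f x = w₁ x * deriv f x - deriv w₁ x * f x := by
  rw [bracket, hw.conj₁, hw.conj_deriv₁]

theorem IsReferencePair.bracket_left₂ (hw : IsReferencePair q w₁ w₂) (f : ℝ → ℂ) (x : ℝ) :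
    bracket w₂ f x = w₂ x * deriv f x - deriv w₂ x * f x := by
  rw [bracket, hw.conj₂, hw.conj_deriv₂]

/-- By Lagrange's identity the bracket of two solutions is constant; its value is read off at `+∞`.
-/
theorem IsReferencePair.wronskian (hw : IsReferencePair q w₁ w₂) (x : ℝ) :
    w₁ x * deriv w₂ x - deriv w₁ x * w₂ x = 1 := by
  rw [← hw.bracket_left₁]
  have hc : ∀ y, bracket w₁ w₂ y = bracket w₁ w₂ x := fun y => by
    refine (hw.sol₁.regular.bracket_locAC hw.sol₂.regular).eq_add_of_ae_hasDerivAt_zero ?_ _ _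
    filter_upwards [hw.sol₁.regular.ae_hasDerivAt_bracket hw.sol₂.regular q, hw.sol₁.eqn,
      hw.sol₂.eqn] with t ht h1 h2
    simpa [h1, h2] using ht
  have := hw.bracket_top
  rw [funext hc] at this
  exact tendsto_nhds_unique tendsto_const_nhds this

/-- Expanding the right side gives the left side times the Wronskian, which is 1. -/
theorem IsReferencePair.bracket_eq (hw : IsReferencePair q w₁ w₂) (f g : ℝ → ℂ) (x : ℝ) :
    bracket f g x = conj (bracket w₁ f x) * bracket w₂ g x
      - conj (bracket w₂ f x) * bracket w₁ g x := by
  rw [hw.bracket_left₁, hw.bracket_left₁, hw.bracket_left₂, hw.bracket_left₂]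
  simp only [map_sub, map_mul, hw.conj₁, hw.conj₂, hw.conj_deriv₁, hw.conj_deriv₂, bracket]
  linear_combination -(conj (f x) * deriv g x - conj (deriv f x) * g x) * hw.wronskian x

/-! ### Variation of parameters -/

/-- The solution of `τ_q z = h` with vanishing initial values at `c`. -/
def variation (w₁ w₂ h : ℝ → ℂ) (c x : ℝ) : ℂ :=
  w₁ x * (∫ t in c..x, h t * w₂ t) - w₂ x * ∫ t in c..x, h t * w₁ t

/-- The derivative of `variation w₁ w₂ h c`. -/
def variationDeriv (w₁ w₂ h : ℝ → ℂ) (c x : ℝ) : ℂ :=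
  deriv w₁ x * (∫ t in c..x, h t * w₂ t) - deriv w₂ x * ∫ t in c..x, h t * w₁ t

theorem IsReferencePair.variationDeriv_locAC (hw : IsReferencePair q w₁ w₂) {h : ℝ → ℂ}
    (hh : LocallyIntegrable h volume) (c : ℝ) : LocAC (variationDeriv w₁ w₂ h c) :=
  (hw.sol₁.regular.ac_deriv.mul
    (locAC_integral (hh.mul_continuous' hw.sol₂.regular.continuous) c)).sub
  (hw.sol₂.regular.ac_deriv.mul
    (locAC_integral (hh.mul_continuous' hw.sol₁.regular.continuous) c))

/-- The terms `h * w₁ * w₂` from differentiating the integrals cancel. The product rule holds only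
almost everywhere, but the resulting derivative is continuous. -/
theorem IsReferencePair.hasDerivAt_variation (hw : IsReferencePair q w₁ w₂) {h : ℝ → ℂ}
    (hh : LocallyIntegrable h volume) (c x : ℝ) :
    HasDerivAt (variation w₁ w₂ h c) (variationDeriv w₁ w₂ h c x) x := by
  have l1 := hh.mul_continuous' hw.sol₁.regular.continuous
  have l2 := hh.mul_continuous' hw.sol₂.regular.continuous
  refine LocAC.hasDerivAt_of_ae ((hw.sol₁.regular.ac.mul (locAC_integral l2 c)).sub
    (hw.sol₂.regular.ac.mul (locAC_integral l1 c)))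
    (hw.variationDeriv_locAC hh c).continuous ?_ x
  filter_upwards [LocallyIntegrable.ae_hasDerivAt_integral l1,
    LocallyIntegrable.ae_hasDerivAt_integral l2] with t h1 h2
  have := ((hw.sol₁.regular.diff t).hasDerivAt.mul (h2 c)).sub
    ((hw.sol₂.regular.diff t).hasDerivAt.mul (h1 c))
  refine this.congr_deriv ?_
  simp only [variationDeriv]; ring

theorem IsReferencePair.variation_regular (hw : IsReferencePair q w₁ w₂) {h : ℝ → ℂ}
    (hh : LocallyIntegrable h volume) (c : ℝ) : Regular (variation w₁ w₂ h c) :=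
  Regular.of_hasDerivAt (hw.hasDerivAt_variation hh c) (hw.variationDeriv_locAC hh c)

/-- Differentiating the integrals in `variationDeriv` contributes `-h` times the Wronskian. -/
theorem IsReferencePair.tau_variation (hw : IsReferencePair q w₁ w₂) {h : ℝ → ℂ}
    (hh : LocallyIntegrable h volume) (c : ℝ) : tau q (variation w₁ w₂ h c) =ᵐ[volume] h := by
  have l1 := hh.mul_continuous' hw.sol₁.regular.continuous
  have l2 := hh.mul_continuous' hw.sol₂.regular.continuous
  refine tau_ae_eq (hw.hasDerivAt_variation hh c) ?_
  filter_upwards [LocallyIntegrable.ae_hasDerivAt_integral l1,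
    LocallyIntegrable.ae_hasDerivAt_integral l2, hw.sol₁.regular.ae_hasDerivAt_deriv q,
    hw.sol₂.regular.ae_hasDerivAt_deriv q, hw.sol₁.eqn, hw.sol₂.eqn] with t h1 h2 d1 d2 e1 e2
  have := (d1.mul (h2 c)).sub (d2.mul (h1 c))
  refine this.congr_deriv ?_
  simp only [variation, e1, e2]
  linear_combination -h t * hw.wronskian t

end ReferencePair

/-! ### Cutting off a solution -/

/-- A smooth function which vanishes on `(-∞, 0]` and equals `1` on `[1, ∞)`. -/
def cutoff (x : ℝ) : ℂ := (Real.smoothTransition x : ℂ)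

theorem cutoff_contDiff {n : ℕ∞} : ContDiff ℝ n cutoff :=
  Complex.ofRealCLM.contDiff.comp Real.smoothTransition.contDiff

theorem cutoff_of_nonpos {x : ℝ} (hx : x ≤ 0) : cutoff x = 0 := by
  simp [cutoff, Real.smoothTransition.zero_of_nonpos hx]

theorem cutoff_of_one_le {x : ℝ} (hx : 1 ≤ x) : cutoff x = 1 := by
  simp [cutoff, Real.smoothTransition.one_of_one_le hx]

theorem norm_cutoff_le (x : ℝ) : ‖cutoff x‖ ≤ 1 := by
  rw [cutoff, Complex.norm_real, Real.norm_eq_abs,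
    abs_of_nonneg (Real.smoothTransition.nonneg x)]
  exact Real.smoothTransition.le_one x

theorem deriv_cutoff_contDiff {n : ℕ} : ContDiff ℝ n (deriv cutoff) := by
  have : ContDiff ℝ ((n + 1 : ℕ∞) : WithTop ℕ∞) cutoff := cutoff_contDiff
  have h := (contDiff_succ_iff_deriv (n := (n : WithTop ℕ∞))).1 (by exact_mod_cast this)
  exact h.2.2

theorem deriv_cutoff_eq_zero {x : ℝ} (hx : x ∉ Set.Icc (0 : ℝ) 1) : deriv cutoff x = 0 := by
  rw [Set.mem_Icc, not_and_or, not_le, not_le] at hx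
  rcases hx with hx | hx
  · have : cutoff =ᶠ[𝓝 x] fun _ => 0 := by
      filter_upwards [Iio_mem_nhds hx] with y hy using cutoff_of_nonpos (le_of_lt hy)
    rw [this.deriv_eq]; simp
  · have : cutoff =ᶠ[𝓝 x] fun _ => 1 := by
      filter_upwards [Ioi_mem_nhds hx] with y hy using cutoff_of_one_le (le_of_lt hy)
    rw [this.deriv_eq]; simp

theorem hasDerivAt_cutoff (x : ℝ) : HasDerivAt cutoff (deriv cutoff x) x :=
  ((cutoff_contDiff (n := 1)).differentiable (by simp) x).hasDerivAt

theorem hasDerivAt_cutoff_mul {y : ℝ → ℂ} (hy : Regular y) (x : ℝ) :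
    HasDerivAt (fun x => cutoff x * y x) (deriv cutoff x * y x + cutoff x * deriv y x) x :=
  (hasDerivAt_cutoff x).mul (hy.diff x).hasDerivAt

theorem Regular.cutoff_mul {y : ℝ → ℂ} (hy : Regular y) : Regular (fun x => cutoff x * y x) :=
  Regular.of_hasDerivAt (hasDerivAt_cutoff_mul hy)
    (((LocAC.of_contDiff (deriv_cutoff_contDiff (n := 1))).mul hy.ac).add
      ((LocAC.of_contDiff (cutoff_contDiff (n := 1))).mul hy.ac_deriv))

/-- The function `-χ'' y - 2 χ' y'`, where `χ` is the cutoff. -/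
def cutoffTau (y : ℝ → ℂ) (x : ℝ) : ℂ :=
  -(deriv (deriv cutoff) x * y x + 2 * (deriv cutoff x * deriv y x))

/-- The term χ τy vanishes, so only the commutator of τ with the cutoff χ survives. -/
theorem IsSolution.tau_cutoff_mul {q : ℝ → ℝ} {y : ℝ → ℂ} (hy : IsSolution q 0 y) :
    tau q (fun x => cutoff x * y x) =ᵐ[volume] cutoffTau y := by
  refine tau_ae_eq (hasDerivAt_cutoff_mul hy.regular) ?_
  filter_upwards [hy.regular.ae_hasDerivAt_deriv q, hy.eqn] with x h1 h2
  have h3 : HasDerivAt (deriv cutoff) (deriv (deriv cutoff) x) x :=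
    ((deriv_cutoff_contDiff (n := 1)).differentiable (by simp) x).hasDerivAt
  have := (h3.mul (hy.regular.diff x).hasDerivAt).add ((hasDerivAt_cutoff x).mul h1)
  refine this.congr_deriv ?_
  rw [h2, cutoffTau]; ring

theorem Regular.continuous_cutoffTau {y : ℝ → ℂ} (hy : Regular y) : Continuous (cutoffTau y) := by
  have h1 := (deriv_cutoff_contDiff (n := 1)).continuous_deriv le_rfl
  have h2 := (deriv_cutoff_contDiff (n := 1)).continuous
  have := hy.continuous
  have := hy.deriv_continuous
  unfold cutoffTau
  fun_prop

theorem hasCompactSupport_cutoffTau (y : ℝ → ℂ) : HasCompactSupport (cutoffTau y) := by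
  have h1 : HasCompactSupport (deriv cutoff) :=
    HasCompactSupport.intro isCompact_Icc fun _ hx => deriv_cutoff_eq_zero hx
  exact ((h1.deriv.mul_right (f' := y)).add (h1.mul_right (f' := deriv y)).mul_left).neg

theorem IsSolution.memLp_tau_cutoff_mul {q : ℝ → ℝ} {y : ℝ → ℂ} (hy : IsSolution q 0 y) :
    MemLp (tau q (fun x => cutoff x * y x)) 2 volume :=
  MemLp.ae_eq hy.tau_cutoff_mul.symm (hy.regular.continuous_cutoffTau.memLp_of_hasCompactSupport
    (hasCompactSupport_cutoffTau y))

/-! ### Boundary values of the maximal domain -/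

section Maximal

variable {q : ℝ → ℝ} {w₁ w₂ : ℝ → ℂ}

theorem IsSolution.mem_maxFun {w : ℝ → ℂ} (hTop : IsLimitCircleTop q) (hBot : IsLimitCircleBot q)
    (hw : IsSolution q 0 w) : w ∈ maxFun q := by
  refine ⟨hw.regular, ?_, ?_⟩
  · obtain ⟨a, ha⟩ := hTop 0 w hw
    obtain ⟨b, hb⟩ := hBot 0 w hw
    have hc := hw.regular.continuous
    rw [memLp_two_iff_integrable_sq_norm hc.aestronglyMeasurable, ← integrableOn_univ]
    have h1 : IntegrableOn (fun x => ‖w x‖ ^ 2) (Set.Ioi a) volume :=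
      (memLp_two_iff_integrable_sq_norm hc.aestronglyMeasurable).1 ha
    have h2 : IntegrableOn (fun x => ‖w x‖ ^ 2) (Set.Iio b) volume :=
      (memLp_two_iff_integrable_sq_norm hc.aestronglyMeasurable).1 hb
    have h3 : IntegrableOn (fun x => ‖w x‖ ^ 2) (Set.Icc b a) volume :=
      (hc.norm.pow 2).integrableOn_Icc
    -- The two tails and the compact interval `[b, a]` (possibly empty) cover the line.
    refine ((h1.union h2).union h3).mono_set fun x _ => ?_
    simp only [Set.mem_union, Set.mem_Ioi, Set.mem_Iio, Set.mem_Icc]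
    by_contra! h
    linarith [h.1.1, h.1.2, h.2 h.1.2]
  · refine MemLp.ae_eq (f := 0) ?_ MemLp.zero
    filter_upwards [hw.eqn] with x hx
    simp [hx]

/-- A reference pair of solutions which are square integrable on the whole line. -/
structure IsMaxPair (q : ℝ → ℝ) (w₁ w₂ : ℝ → ℂ) : Prop extends IsReferencePair q w₁ w₂ where
  mem₁ : w₁ ∈ maxFun q
  mem₂ : w₂ ∈ maxFun q

theorem memLp_two_conj {f : ℝ → ℂ} (hf : MemLp f 2 volume) :
    MemLp (fun x => conj (f x)) 2 volume :=
  hf.of_le (Complex.continuous_conj.comp_aestronglyMeasurable hf.1) (ae_of_all _ fun x => by simp)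

theorem locallyIntegrable_of_memLp {f : ℝ → ℂ} (hf : MemLp f 2 volume) :
    LocallyIntegrable f volume :=
  hf.locallyIntegrable (by norm_num)

theorem inner_toLp {f g : ℝ → ℂ} (hf : MemLp f 2 volume) (hg : MemLp g 2 volume) :
    inner ℂ (hf.toLp f : L2) (hg.toLp g) = ∫ x, conj (f x) * g x := by
  rw [L2.inner_def]
  refine integral_congr_ae ?_
  filter_upwards [hf.coeFn_toLp, hg.coeFn_toLp] with x h1 h2
  rw [h1, h2, RCLike.inner_apply, mul_comm]

theorem integrable_conj_mul {f g : ℝ → ℂ} (hf : MemLp f 2 volume) (hg : MemLp g 2 volume) :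
    Integrable (fun x => conj (f x) * g x) volume :=
  (memLp_two_conj hf).integrable_mul hg

/-- The derivative of the bracket is a difference of products of `L²` functions, hence integrable on
the line. So the bracket converges at both ends, and its total increment is the difference of inner
products. -/
theorem exists_tendsto_bracket (f g : maxFun q) : ∃ lb lt : ℂ,
    Tendsto (bracket f g) atBot (𝓝 lb) ∧ Tendsto (bracket f g) atTop (𝓝 lt) ∧
    inner ℂ (tauL2 q f) (toL2 q g) - inner ℂ (toL2 q f) (tauL2 q g) = lt - lb := by
  obtain ⟨f, rf, mf, tf⟩ := f
  obtain ⟨g, rg, mg, tg⟩ := g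
  have i1 := integrable_conj_mul tf mg
  have i2 := integrable_conj_mul mf tg
  have hi : Integrable (fun x => conj (tau q f x) * g x - conj (f x) * tau q g x) volume :=
    i1.sub i2
  have hb : ∀ a b, ∫ x in a..b, (conj (tau q f x) * g x - conj (f x) * tau q g x) =
      bracket f g b - bracket f g a :=
    rf.integral_bracket rg (locallyIntegrable_of_memLp tf) (locallyIntegrable_of_memLp tg)
  refine ⟨bracket f g 0 - ∫ x in Set.Iic (0 : ℝ), (conj (tau q f x) * g x - conj (f x) * tau q g x),
    bracket f g 0 + ∫ x in Set.Ioi (0 : ℝ), (conj (tau q f x) * g x - conj (f x) * tau q g x),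
    ?_, ?_, ?_⟩
  · have := intervalIntegral_tendsto_integral_Iic (0 : ℝ) hi.integrableOn tendsto_id
    refine (this.const_sub (bracket f g 0)).congr fun a => ?_
    have := hb a 0
    simp only [id, this]; ring
  · have := intervalIntegral_tendsto_integral_Ioi (0 : ℝ) hi.integrableOn tendsto_id
    refine (this.const_add (bracket f g 0)).congr fun a => ?_
    have := hb 0 a
    simp only [id, this]; ring
  · have h1 : inner ℂ (tauL2 q ⟨f, rf, mf, tf⟩) (toL2 q ⟨g, rg, mg, tg⟩) = _ := inner_toLp tf mg
    have h2 : inner ℂ (toL2 q ⟨f, rf, mf, tf⟩) (tauL2 q ⟨g, rg, mg, tg⟩) = _ := inner_toLp mf tg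
    rw [h1, h2, ← integral_sub i1 i2, ← intervalIntegral.integral_Iic_add_Ioi
      (b := (0 : ℝ)) hi.integrableOn hi.integrableOn]
    ring

theorem tendsto_bvBot (f g : maxFun q) : Tendsto (bracket f g) atBot (𝓝 (bvBot f g)) := by
  obtain ⟨lb, lt, h, -, -⟩ := exists_tendsto_bracket f g
  exact tendsto_nhds_limUnder ⟨_, h⟩

theorem tendsto_bvTop (f g : maxFun q) : Tendsto (bracket f g) atTop (𝓝 (bvTop f g)) := by
  obtain ⟨lb, lt, -, h, -⟩ := exists_tendsto_bracket f g
  exact tendsto_nhds_limUnder ⟨_, h⟩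

theorem inner_tau_sub_inner_tau (f g : maxFun q) :
    inner ℂ (tauL2 q f) (toL2 q g) - inner ℂ (toL2 q f) (tauL2 q g) = bvTop f g - bvBot f g := by
  obtain ⟨lb, lt, h1, h2, h3⟩ := exists_tendsto_bracket f g
  rw [h3, bvTop, bvBot, h1.limUnder_eq, h2.limUnder_eq]

theorem bvBot_add (f g h : maxFun q) : bvBot f (g + h : maxFun q) = bvBot f g + bvBot f h :=
  tendsto_nhds_unique (tendsto_bvBot f (g + h)) <|
    ((tendsto_bvBot f g).add (tendsto_bvBot f h)).congr fun x =>
      (bracket_add_right g.2.1 h.2.1 x).symm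

theorem bvTop_add (f g h : maxFun q) : bvTop f (g + h : maxFun q) = bvTop f g + bvTop f h :=
  tendsto_nhds_unique (tendsto_bvTop f (g + h)) <|
    ((tendsto_bvTop f g).add (tendsto_bvTop f h)).congr fun x =>
      (bracket_add_right g.2.1 h.2.1 x).symm

theorem bvBot_smul (c : ℂ) (f g : maxFun q) : bvBot f (c • g : maxFun q) = c * bvBot f g :=
  tendsto_nhds_unique (tendsto_bvBot f (c • g)) <|
    ((tendsto_bvBot f g).const_mul c).congr fun x => (bracket_smul_right c g.2.1 x).symm

theorem bvTop_smul (c : ℂ) (f g : maxFun q) : bvTop f (c • g : maxFun q) = c * bvTop f g :=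
  tendsto_nhds_unique (tendsto_bvTop f (c • g)) <|
    ((tendsto_bvTop f g).const_mul c).congr fun x => (bracket_smul_right c g.2.1 x).symm

/-- The space of boundary values `((α₁, α₂), (β₁, β₂))`. -/
abbrev BV : Type := (Fin 2 → ℂ) × (Fin 2 → ℂ)

/-- The boundary values `((α₁, α₂), (β₁, β₂))` as a linear map. -/
def boundary (hw : IsMaxPair q w₁ w₂) : maxFun q →ₗ[ℂ] BV where
  toFun y := (![bvBot w₁ y, bvBot w₂ y], ![bvTop w₁ y, bvTop w₂ y])
  map_add' y z := by
    rw [bvBot_add ⟨w₁, hw.mem₁⟩ y z, bvBot_add ⟨w₂, hw.mem₂⟩ y z, bvTop_add ⟨w₁, hw.mem₁⟩ y z,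
      bvTop_add ⟨w₂, hw.mem₂⟩ y z]
    simp
  map_smul' c y := by
    rw [bvBot_smul c ⟨w₁, hw.mem₁⟩ y, bvBot_smul c ⟨w₂, hw.mem₂⟩ y,
      bvTop_smul c ⟨w₁, hw.mem₁⟩ y, bvTop_smul c ⟨w₂, hw.mem₂⟩ y]
    simp

/-- The sesquilinear boundary form. -/
def symp (u v : Fin 2 → ℂ) : ℂ := conj (u 0) * v 1 - conj (u 1) * v 0

/-- The limit at `-∞` of the pointwise identity `IsReferencePair.bracket_eq`. -/
theorem IsMaxPair.bvBot_eq (hw : IsMaxPair q w₁ w₂) (f g : maxFun q) :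
    bvBot f g = symp (boundary hw f).1 (boundary hw g).1 := by
  refine tendsto_nhds_unique (tendsto_bvBot f g) (Tendsto.congr
    (fun x => (hw.bracket_eq f g x).symm) ?_)
  have h1 := tendsto_bvBot ⟨w₁, hw.mem₁⟩
  have h2 := tendsto_bvBot ⟨w₂, hw.mem₂⟩
  exact (((Complex.continuous_conj.tendsto _).comp (h1 f)).mul (h2 g)).sub
    (((Complex.continuous_conj.tendsto _).comp (h2 f)).mul (h1 g))

theorem IsMaxPair.bvTop_eq (hw : IsMaxPair q w₁ w₂) (f g : maxFun q) :
    bvTop f g = symp (boundary hw f).2 (boundary hw g).2 := by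
  refine tendsto_nhds_unique (tendsto_bvTop f g) (Tendsto.congr
    (fun x => (hw.bracket_eq f g x).symm) ?_)
  have h1 := tendsto_bvTop ⟨w₁, hw.mem₁⟩
  have h2 := tendsto_bvTop ⟨w₂, hw.mem₂⟩
  exact (((Complex.continuous_conj.tendsto _).comp (h1 f)).mul (h2 g)).sub
    (((Complex.continuous_conj.tendsto _).comp (h2 f)).mul (h1 g))

/-- Green's formula on the maximal domain. -/
theorem IsMaxPair.green (hw : IsMaxPair q w₁ w₂) (f g : maxFun q) :
    inner ℂ (tauL2 q f) (toL2 q g) - inner ℂ (toL2 q f) (tauL2 q g) =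
      symp (boundary hw f).2 (boundary hw g).2 - symp (boundary hw f).1 (boundary hw g).1 := by
  rw [inner_tau_sub_inner_tau, hw.bvTop_eq, hw.bvBot_eq]

/-! ### Locality and surjectivity of the boundary map -/

theorem bvBot_congr {w y z : ℝ → ℂ} (h : y =ᶠ[atBot] z) : bvBot w y = bvBot w z := by
  have : bracket w y =ᶠ[atBot] bracket w z := by
    obtain ⟨a, ha⟩ := eventually_atBot.1 h
    -- The strict inequality leaves a neighbourhood of `x` on which the functions agree, so that
    -- their derivatives agree too.
    filter_upwards [eventually_lt_atBot a] with x hx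
    have h1 : y =ᶠ[𝓝 x] z := by
      filter_upwards [Iio_mem_nhds hx] with t ht using ha t (le_of_lt ht)
    rw [bracket, bracket, h1.deriv_eq, h1.eq_of_nhds]
  rw [bvBot, bvBot, limUnder, limUnder, Filter.map_congr this]

theorem bvTop_congr {w y z : ℝ → ℂ} (h : y =ᶠ[atTop] z) : bvTop w y = bvTop w z := by
  have : bracket w y =ᶠ[atTop] bracket w z := by
    obtain ⟨a, ha⟩ := eventually_atTop.1 h
    filter_upwards [eventually_gt_atTop a] with x hx
    have h1 : y =ᶠ[𝓝 x] z := by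
      filter_upwards [Ioi_mem_nhds hx] with t ht using ha t (le_of_lt ht)
    rw [bracket, bracket, h1.deriv_eq, h1.eq_of_nhds]
  rw [bvTop, bvTop, limUnder, limUnder, Filter.map_congr this]

theorem boundary_fst_congr (hw : IsMaxPair q w₁ w₂) {y z : maxFun q}
    (h : (y : ℝ → ℂ) =ᶠ[atBot] z) : (boundary hw y).1 = (boundary hw z).1 := by
  simp only [boundary, LinearMap.coe_mk, AddHom.coe_mk, bvBot_congr h]

theorem boundary_snd_congr (hw : IsMaxPair q w₁ w₂) {y z : maxFun q}
    (h : (y : ℝ → ℂ) =ᶠ[atTop] z) : (boundary hw y).2 = (boundary hw z).2 := by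
  simp only [boundary, LinearMap.coe_mk, AddHom.coe_mk, bvTop_congr h]

theorem boundary_eq_zero_of_hasCompactSupport (hw : IsMaxPair q w₁ w₂) {y : maxFun q}
    (hy : HasCompactSupport (y : ℝ → ℂ)) : boundary hw y = 0 := by
  have h : (y : ℝ → ℂ) =ᶠ[cocompact ℝ] (0 : maxFun q) :=
    hasCompactSupport_iff_eventuallyEq.1 hy |>.filter_mono
      (by exact coclosedCompact_eq_cocompact.ge)
  refine (Prod.ext (boundary_fst_congr hw (z := 0) (h.filter_mono atBot_le_cocompact))
    (boundary_snd_congr hw (z := 0) (h.filter_mono atTop_le_cocompact))).trans (map_zero _)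

theorem IsSolution.cutoff_mul_mem {w : ℝ → ℂ} (hs : IsSolution q 0 w) (hw : w ∈ maxFun q) :
    (fun x => cutoff x * w x) ∈ maxFun q := by
  refine ⟨hs.regular.cutoff_mul, ?_, hs.memLp_tau_cutoff_mul⟩
  refine hw.2.1.of_le hs.regular.cutoff_mul.continuous.aestronglyMeasurable
    (ae_of_all _ fun x => ?_)
  rw [norm_mul]
  exact mul_le_of_le_one_left (norm_nonneg _) (norm_cutoff_le x)

theorem IsMaxPair.boundary_solution (hw : IsMaxPair q w₁ w₂) :
    boundary hw ⟨w₁, hw.mem₁⟩ = (![0, -1], ![0, -1]) ∧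
    boundary hw ⟨w₂, hw.mem₂⟩ = (![1, 0], ![1, 0]) := by
  have h11 : bracket w₁ w₁ = fun _ => 0 := by
    ext x; rw [hw.bracket_left₁]; ring
  have h12 : bracket w₁ w₂ = fun _ => 1 := by
    ext x; rw [hw.bracket_left₁, hw.wronskian]
  have h21 : bracket w₂ w₁ = fun _ => -1 := by
    ext x; rw [hw.bracket_left₂]; linear_combination -hw.wronskian x
  have h22 : bracket w₂ w₂ = fun _ => 0 := by
    ext x; rw [hw.bracket_left₂]; ring
  simp only [boundary, LinearMap.coe_mk, AddHom.coe_mk, bvBot, bvTop, h11, h12, h21, h22,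
    tendsto_const_nhds.limUnder_eq, and_self]

/-- The solutions have the same boundary values at both ends and span the diagonal; their cut-offs
keep only the values at `+∞`. -/
theorem boundary_surjective (hw : IsMaxPair q w₁ w₂) : Function.Surjective (boundary hw) := by
  have key : ∀ w : maxFun q, IsSolution q 0 w → ∃ z : maxFun q,
      boundary hw z = (0, (boundary hw w).2) := by
    intro w hs
    refine ⟨⟨_, hs.cutoff_mul_mem w.2⟩, Prod.ext ?_ ?_⟩
    · have : boundary hw (0 : maxFun q) = 0 := map_zero _
      refine (boundary_fst_congr hw (z := 0) ?_).trans (by rw [this]; rfl)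
      filter_upwards [eventually_le_atBot 0] with x hx
      simp [cutoff_of_nonpos hx]
    · refine boundary_snd_congr hw ?_
      filter_upwards [eventually_ge_atTop 1] with x hx
      simp [cutoff_of_one_le hx]
  obtain ⟨z₁, h₁⟩ := key ⟨w₁, hw.mem₁⟩ hw.sol₁
  obtain ⟨z₂, h₂⟩ := key ⟨w₂, hw.mem₂⟩ hw.sol₂
  obtain ⟨e₁, e₂⟩ := hw.boundary_solution
  rintro ⟨a, b⟩
  -- The solutions produce `a` at both ends; the cut-offs then add `b - a` at `+∞`.
  refine ⟨(-a 1) • (⟨w₁, hw.mem₁⟩ : maxFun q) + a 0 • (⟨w₂, hw.mem₂⟩ : maxFun q) +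
    (a 1 - b 1) • z₁ + (b 0 - a 0) • z₂, ?_⟩
  simp only [map_add, map_smul, h₁, h₂, e₁, e₂]
  refine Prod.ext (funext fun i => ?_) (funext fun i => ?_) <;> fin_cases i <;> simp

end Maximal

/-! ### Weak solutions -/

section Weak

variable {q : ℝ → ℝ} {w₁ w₂ : ℝ → ℂ}

theorem integrable_mul_of_hasCompactSupport {u k : ℝ → ℂ} (hu : LocallyIntegrable u volume)
    (hk : Continuous k) (hs : HasCompactSupport k) : Integrable (fun x => u x * k x) volume := by
  simpa only [smul_eq_mul, mul_comm] using hu.integrable_smul_left_of_hasCompactSupport hk hs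

theorem tau_eq_zero_of_eventuallyEq {y : ℝ → ℂ} {x : ℝ} (h : y =ᶠ[𝓝 x] 0) : tau q y x = 0 := by
  have h1 : deriv (deriv y) x = 0 := by
    rw [h.deriv.deriv_eq]
    simp
  simp [tau, h1, h.eq_of_nhds]

/-- Equality of germs makes the derivatives vanish as well. The bound `1 ≤ R` keeps the transition
interval `[0, 1]` of the cutoff inside `[-R, R]`. -/
theorem HasCompactSupport.exists_forall_abs {f : ℝ → ℂ} (hf : HasCompactSupport f) :
    ∃ R : ℝ, 1 ≤ R ∧ ∀ x, R ≤ |x| → f =ᶠ[𝓝 x] 0 := by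
  obtain ⟨R, hR⟩ := hf.isCompact.isBounded.subset_closedBall 0
  refine ⟨max 1 (R + 1), le_max_left _ _, fun x hx => ?_⟩
  refine notMem_tsupport_iff_eventuallyEq.1 fun h => ?_
  have h1 := hR h
  have h2 := (le_max_right _ _).trans hx
  rw [mem_closedBall_zero_iff, Real.norm_eq_abs] at h1
  linarith

/-- A regular function `z` is a weak solution of `τ_q z = f`. -/
theorem integral_tau_mul_of_hasCompactSupport {z f : ℝ → ℂ} (hz : Regular z)
    (hf : LocallyIntegrable f volume) (hzf : tau q z =ᵐ[volume] f) (y : maxFun q)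
    (hy : HasCompactSupport (y : ℝ → ℂ)) :
    Integrable (fun x => conj (f x) * (y : ℝ → ℂ) x - conj (z x) * tau q y x) volume ∧
    ∫ x, (conj (f x) * (y : ℝ → ℂ) x - conj (z x) * tau q y x) = 0 := by
  obtain ⟨R, hR, hs⟩ := HasCompactSupport.exists_forall_abs hy
  have hR' : (-R) ≤ R := by linarith
  have e : (fun x => conj (f x) * (y : ℝ → ℂ) x - conj (z x) * tau q y x) =ᵐ[volume]
      fun x => conj (tau q z x) * (y : ℝ → ℂ) x - conj (z x) * tau q y x := by
    filter_upwards [hzf] with x hx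
    rw [hx]
  have lz : LocallyIntegrable (tau q z) volume := hf.congr hzf.symm
  have ly := locallyIntegrable_of_memLp y.2.2.2
  have hb := hz.integral_bracket y.2.1 lz ly (-R) R
  have hL : LocallyIntegrable
      (fun x => conj (tau q z x) * (y : ℝ → ℂ) x - conj (z x) * tau q y x) volume := by
    refine (lz.conj'.mul_continuous' y.2.1.continuous).sub ?_
    simpa only [mul_comm, Function.comp_apply] using
      ly.mul_continuous' (Complex.continuous_conj.comp hz.continuous)
  have h0 : ∀ x, R ≤ |x| →
      conj (tau q z x) * (y : ℝ → ℂ) x - conj (z x) * tau q y x = 0 := fun x hx => by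
    rw [(hs x hx).eq_of_nhds, tau_eq_zero_of_eventuallyEq (hs x hx)]; simp
  have h0b : ∀ x, R ≤ |x| → bracket z y x = 0 := fun x hx => by
    rw [bracket, (hs x hx).deriv_eq, (hs x hx).eq_of_nhds]; simp
  have hsub : Function.support
      (fun x => conj (tau q z x) * (y : ℝ → ℂ) x - conj (z x) * tau q y x) ⊆ Set.Ioc (-R) R := by
    intro x hx
    by_contra hx'
    refine hx (h0 x ?_)
    rw [Set.mem_Ioc, not_and_or, not_lt, not_le] at hx'
    rw [le_abs]
    rcases hx' with h | h
    · right; linarith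
    · left; linarith
  constructor
  · refine Integrable.congr ?_ e.symm
    rw [← integrableOn_iff_integrable_of_support_subset hsub]
    exact (hL.intervalIntegrable' (-R) R).1
  · rw [integral_congr_ae e, ← intervalIntegral.integral_eq_integral_of_support_subset hsub, hb,
      h0b R (le_abs_self R), h0b (-R) (by rw [abs_neg]; exact le_abs_self R), sub_self]

theorem variation_of_le {f : ℝ → ℂ} {R x : ℝ}
    (hf : ∀ x, R ≤ |x| → f x = 0) (hx : x ≤ -R) : variation w₁ w₂ f (-R) x = 0 := by
  have h : ∀ g : ℝ → ℂ, ∫ t in (-R)..x, f t * g t = 0 := fun g => by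
    refine (intervalIntegral.integral_congr (g := fun _ => (0 : ℂ)) fun t ht => ?_).trans (by simp)
    rw [Set.uIcc_of_ge hx] at ht
    have : f t = 0 := hf t (le_abs.2 (Or.inr (by linarith [ht.2])))
    simp [this]
  simp [variation, h]

/-- Past the support of `f` the integrals no longer change, so the solution is a fixed combination
of `w₁` and `w₂`, which a cutoff can cancel. -/
theorem variation_of_ge {f : ℝ → ℂ} {R x : ℝ}
    (hf : ∀ x, R ≤ |x| → f x = 0) (hx : R ≤ x) : variation w₁ w₂ f (-R) x =
      w₁ x * (∫ t, f t * w₂ t) - w₂ x * ∫ t, f t * w₁ t := by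
  have h : ∀ g : ℝ → ℂ, ∫ t in (-R)..x, f t * g t = ∫ t, f t * g t := fun g => by
    refine intervalIntegral.integral_eq_integral_of_support_subset fun t ht => ?_
    by_contra ht'
    refine ht ?_
    rw [Set.mem_Ioc, not_and_or, not_lt, not_le] at ht'
    have : f t = 0 := hf t (le_abs.2 (by rcases ht' with h | h; · right; linarith
                                         · left; linarith))
    simp [this]
  simp only [variation, h]

/-- Every continuous `f` with compact support is, up to a correction supported in `[0, 1]`, of the
form `τ_q y` with `y` of compact support. -/
theorem IsMaxPair.exists_tau_eq (hw : IsMaxPair q w₁ w₂) {f : ℝ → ℂ} (hf : Continuous f)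
    (hs : HasCompactSupport f) : ∃ y : maxFun q, HasCompactSupport (y : ℝ → ℂ) ∧
      tau q y =ᵐ[volume] fun x => f x - (∫ t, f t * w₂ t) * cutoffTau w₁ x
        + (∫ t, f t * w₁ t) * cutoffTau w₂ x := by
  obtain ⟨R, hR, h0⟩ := HasCompactSupport.exists_forall_abs hs
  have h0' : ∀ x, R ≤ |x| → f x = 0 := fun x hx => (h0 x hx).eq_of_nhds
  set c₁ := ∫ t, f t * w₁ t
  set c₂ := ∫ t, f t * w₂ t
  have hl := hf.locallyIntegrable (μ := volume)
  have r1 := hw.variation_regular hl (-R)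
  -- The variation of parameters started at `-R` vanishes to the left of `-R` and equals `c₂ w₁ - c₁
  -- w₂` to the right of `R`; the cut-off solutions remove this tail.
  have r2 := (hw.sol₁.regular.cutoff_mul).smul (-c₂)
  have r3 := (hw.sol₂.regular.cutoff_mul).smul c₁
  have hreg := (r1.add r2).add r3
  have htau : tau q (variation w₁ w₂ f (-R) + (-c₂) • (fun x => cutoff x * w₁ x) +
      c₁ • fun x => cutoff x * w₂ x) =ᵐ[volume] fun x => f x - c₂ * cutoffTau w₁ x
        + c₁ * cutoffTau w₂ x := by
    filter_upwards [tau_add q (r1.add r2) r3, tau_add q r1 r2, hw.tau_variation hl (-R),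
      tau_smul q (-c₂) hw.sol₁.regular.cutoff_mul, tau_smul q c₁ hw.sol₂.regular.cutoff_mul,
      hw.sol₁.tau_cutoff_mul, hw.sol₂.tau_cutoff_mul] with x h1 h2 h3 h4 h5 h6 h7
    rw [h1, Pi.add_apply, h2, Pi.add_apply, h3, h4, h5, Pi.smul_apply, Pi.smul_apply, h6, h7]
    simp only [smul_eq_mul]; ring
  have hcs : HasCompactSupport (variation w₁ w₂ f (-R) + (-c₂) • (fun x => cutoff x * w₁ x) +
      c₁ • fun x => cutoff x * w₂ x) := by
    refine HasCompactSupport.intro (isCompact_Icc (a := -R) (b := R)) fun x hx => ?_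
    rw [Set.mem_Icc, not_and_or, not_le, not_le] at hx
    simp only [Pi.add_apply, Pi.smul_apply, smul_eq_mul]
    rcases hx with hx | hx
    · rw [variation_of_le h0' hx.le, cutoff_of_nonpos (by linarith)]; simp
    · rw [variation_of_ge h0' hx.le, cutoff_of_one_le (by linarith)]; ring
  refine ⟨⟨_, hreg, hreg.continuous.memLp_of_hasCompactSupport hcs, MemLp.ae_eq htau.symm ?_⟩,
    hcs, htau⟩
  exact ((hf.memLp_of_hasCompactSupport hs).sub
    ((hw.sol₁.regular.continuous_cutoffTau.memLp_of_hasCompactSupport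
      (hasCompactSupport_cutoffTau w₁)).const_mul c₂)).add
    ((hw.sol₂.regular.continuous_cutoffTau.memLp_of_hasCompactSupport
      (hasCompactSupport_cutoffTau w₂)).const_mul c₁)

/-- A locally integrable function which annihilates `τ_q y` for all `y` of compact support is a
solution of the homogeneous equation. -/
theorem IsMaxPair.exists_ae_eq_of_integral_tau_eq_zero (hw : IsMaxPair q w₁ w₂) {u : ℝ → ℂ}
    (hu : LocallyIntegrable u volume)
    (h : ∀ y : maxFun q, HasCompactSupport (y : ℝ → ℂ) → ∫ x, u x * tau q y x = 0) :
    ∃ c d : ℂ, ∀ᵐ x, u x = c * w₁ x + d * w₂ x := by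
  set D₁ := ∫ x, u x * cutoffTau w₁ x
  set D₂ := ∫ x, u x * cutoffTau w₂ x
  -- Testing `u` on `τ y` from `exists_tau_eq` gives `∫ u g = D₁ ∫ g w₂ - D₂ ∫ g w₁` for every test
  -- function `g`, which dictates the coefficients.
  refine ⟨-D₂, D₁, ?_⟩
  have l1 := hw.sol₁.regular.continuous
  have l2 := hw.sol₂.regular.continuous
  have hl : LocallyIntegrable (fun x => u x - (-D₂ * w₁ x + D₁ * w₂ x)) volume :=
    hu.sub (Continuous.locallyIntegrable (by fun_prop))
  have hz := ae_eq_zero_of_integral_contDiff_smul_eq_zero hl fun g hg hgs => by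
    have hf : Continuous (fun x => (g x : ℂ)) := Complex.continuous_ofReal.comp hg.continuous
    have hfs : HasCompactSupport (fun x => (g x : ℂ)) := hgs.comp_left Complex.ofReal_zero
    obtain ⟨y, hy, ht⟩ := hw.exists_tau_eq hf hfs
    have i0 := integrable_mul_of_hasCompactSupport hu hf hfs
    have i1 := integrable_mul_of_hasCompactSupport hu hw.sol₁.regular.continuous_cutoffTau
      (hasCompactSupport_cutoffTau w₁)
    have i2 := integrable_mul_of_hasCompactSupport hu hw.sol₂.regular.continuous_cutoffTau
      (hasCompactSupport_cutoffTau w₂)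
    have j1 : Integrable (fun x => (g x : ℂ) * w₁ x) volume := by
      simpa only [mul_comm] using
        integrable_mul_of_hasCompactSupport l1.locallyIntegrable hf hfs
    have j2 : Integrable (fun x => (g x : ℂ) * w₂ x) volume := by
      simpa only [mul_comm] using
        integrable_mul_of_hasCompactSupport l2.locallyIntegrable hf hfs
    have e1 : ∫ x, u x * tau q y x = (∫ x, u x * g x) - (∫ t, g t * w₂ t) * D₁
        + (∫ t, g t * w₁ t) * D₂ := by
      have k : Integrable
          (fun x => u x * g x - (∫ t, g t * w₂ t) * (u x * cutoffTau w₁ x)) volume :=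
        i0.sub (i1.const_mul _)
      rw [← integral_const_mul, ← integral_const_mul, ← integral_sub i0 (i1.const_mul _),
        ← integral_add k (i2.const_mul _)]
      refine integral_congr_ae ?_
      filter_upwards [ht] with x hx
      rw [hx]; ring
    have e2 : ∫ x, g x • (u x - (-D₂ * w₁ x + D₁ * w₂ x)) =
        (∫ x, u x * g x) - ((∫ t, g t * w₂ t) * D₁ - (∫ t, g t * w₁ t) * D₂) := by
      have k : Integrable (fun x => g x * w₂ x * D₁ - g x * w₁ x * D₂) volume :=
        (j2.mul_const _).sub (j1.mul_const _)
      rw [← integral_mul_const, ← integral_mul_const,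
        ← integral_sub (j2.mul_const _) (j1.mul_const _), ← integral_sub i0 k]
      refine integral_congr_ae (ae_of_all _ fun x => ?_)
      simp only [Complex.real_smul]; ring
    rw [e2]
    linear_combination h y hy - e1
  filter_upwards [hz] with x hx
  exact sub_eq_zero.1 hx

/-- Weak solutions are strong solutions: the maximal operator is the adjoint of its restriction to
the functions with compact support. -/
theorem IsMaxPair.exists_of_weak (hw : IsMaxPair q w₁ w₂) {g h : L2}
    (H : ∀ y : maxFun q, HasCompactSupport (y : ℝ → ℂ) →
      inner ℂ h (toL2 q y) = inner ℂ g (tauL2 q y)) :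
    ∃ y : maxFun q, toL2 q y = g ∧ tauL2 q y = h := by
  have mg := Lp.memLp g
  have mh := Lp.memLp h
  have lg := locallyIntegrable_of_memLp mg
  have lh := locallyIntegrable_of_memLp mh
  -- A particular solution of τz = h, not necessarily in `L²`. The difference `g - z` is a weak
  -- solution of the homogeneous equation, hence a combination of `w₁` and `w₂`.
  set z := variation w₁ w₂ h 0
  have rz : Regular z := hw.variation_regular lh 0
  have tz : tau q z =ᵐ[volume] h := hw.tau_variation lh 0
  have lu : LocallyIntegrable (fun x => conj (g x - z x)) volume :=
    (lg.sub rz.continuous.locallyIntegrable).conj'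
  obtain ⟨c, d, hcd⟩ := hw.exists_ae_eq_of_integral_tau_eq_zero lu fun y hy => by
    obtain ⟨i1, e1⟩ := integral_tau_mul_of_hasCompactSupport rz lh tz y hy
    have e2 := H y hy
    have h1 : inner ℂ h (toL2 q y) = ∫ x, conj (h x) * (y : ℝ → ℂ) x := by
      have := inner_toLp mh y.2.2.1
      rwa [Lp.toLp_coeFn] at this
    have h2 : inner ℂ g (tauL2 q y) = ∫ x, conj (g x) * tau q y x := by
      have := inner_toLp mg y.2.2.2
      rwa [Lp.toLp_coeFn] at this
    have i2 := integrable_conj_mul mh y.2.2.1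
    have i3 := integrable_conj_mul mg y.2.2.2
    have : ∫ x, conj (g x - z x) * tau q y x =
        (∫ x, (conj (h x) * (y : ℝ → ℂ) x - conj (z x) * tau q y x)) -
        ((∫ x, conj (h x) * (y : ℝ → ℂ) x) - ∫ x, conj (g x) * tau q y x) := by
      have k : Integrable
          (fun x => conj (h x) * (y : ℝ → ℂ) x - conj (g x) * tau q y x) volume := i2.sub i3
      rw [← integral_sub i2 i3, ← integral_sub i1 k]
      refine integral_congr_ae (ae_of_all _ fun x => ?_)
      simp only [map_sub]; ring
    rw [this, e1, ← h1, ← h2, e2]; ring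
  have r1 := hw.sol₁.regular.smul (conj c)
  have r2 := hw.sol₂.regular.smul (conj d)
  have hreg := (rz.add r1).add r2
  have hg : (g : ℝ → ℂ) =ᵐ[volume] z + conj c • w₁ + conj d • w₂ := by
    filter_upwards [hcd] with x hx
    have := congrArg conj hx
    simp only [Complex.conj_conj, map_add, map_mul, hw.conj₁, hw.conj₂] at this
    simp only [Pi.add_apply, Pi.smul_apply, smul_eq_mul]
    linear_combination this
  have ht : tau q (z + conj c • w₁ + conj d • w₂) =ᵐ[volume] h := by
    filter_upwards [tau_add q (rz.add r1) r2, tau_add q rz r1, tz,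
      tau_smul q (conj c) hw.sol₁.regular, tau_smul q (conj d) hw.sol₂.regular,
      hw.sol₁.eqn, hw.sol₂.eqn] with x h1 h2 h3 h4 h5 h6 h7
    rw [h1, Pi.add_apply, h2, Pi.add_apply, h3, h4, h5, Pi.smul_apply, Pi.smul_apply, h6, h7]
    simp
  refine ⟨⟨_, hreg, mg.ae_eq hg, mh.ae_eq ht.symm⟩, Lp.ext ?_, Lp.ext ?_⟩
  · exact (MemLp.coeFn_toLp (mg.ae_eq hg)).trans hg.symm
  · exact (MemLp.coeFn_toLp (mh.ae_eq ht.symm)).trans ht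

end Weak

/-! ### Restrictions of the maximal operator and their adjoints -/

section Operators

variable {q : ℝ → ℝ} {w₁ w₂ : ℝ → ℂ}

theorem maxOp_apply (y : maxFun q) (h : toL2 q y ∈ (maxOp q).domain) :
    maxOp q ⟨toL2 q y, h⟩ = tauL2 q y := by
  change tauL2 q ((LinearEquiv.ofInjective (toL2 q) (toL2_injective q)).symm _) = _
  congr 1
  exact (LinearEquiv.symm_apply_eq _).2 rfl

theorem apply_eq_tauL2 {T : L2 →ₗ.[ℂ] L2} (hT : T ≤ maxOp q) (y : maxFun q)
    (h : toL2 q y ∈ T.domain) : T ⟨toL2 q y, h⟩ = tauL2 q y := by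
  rw [← maxOp_apply y ⟨y, rfl⟩]
  exact hT.2 rfl

theorem mem_graph_maxOp_iff {x z : L2} :
    (x, z) ∈ (maxOp q).graph ↔ ∃ y : maxFun q, toL2 q y = x ∧ tauL2 q y = z := by
  rw [LinearPMap.mem_graph_iff]
  constructor
  · rintro ⟨⟨_, y, rfl⟩, h1, h2⟩
    exact ⟨y, h1, (maxOp_apply y _).symm.trans h2⟩
  · rintro ⟨y, rfl, rfl⟩
    exact ⟨⟨toL2 q y, y, rfl⟩, rfl, maxOp_apply y _⟩

/-- If `h` is orthogonal to all functions of compact support in the maximal domain, then 0 is a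
weak, hence strong, solution of τ0 = h, so `h = 0`. -/
theorem dense_of_preMinDomain_le (hw : IsMaxPair q w₁ w₂) {S : Submodule ℂ L2}
    (hS : preMinDomain q ≤ S) : Dense (S : Set L2) := by
  refine Dense.mono hS ?_
  rw [Submodule.dense_iff_topologicalClosure_eq_top, Submodule.topologicalClosure_eq_top_iff,
    Submodule.eq_bot_iff]
  intro h hh
  obtain ⟨y, hy, hy'⟩ := hw.exists_of_weak (g := 0) (h := h) fun y hy => by
    rw [inner_zero_left]
    exact Submodule.inner_left_of_mem_orthogonal (K := preMinDomain q) ⟨y, hy, rfl⟩ hh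
  have : y = 0 := toL2_injective q (hy.trans (map_zero _).symm)
  rw [← hy', this, map_zero]

theorem exists_of_mem_adjoint_domain (hw : IsMaxPair q w₁ w₂) {T : L2 →ₗ.[ℂ] L2}
    (hT : T ≤ maxOp q) (hS : preMinDomain q ≤ T.domain) (g : T.adjoint.domain) :
    ∃ y : maxFun q, toL2 q y = g ∧ tauL2 q y = T.adjoint g := by
  refine hw.exists_of_weak fun y hy => ?_
  have hm : toL2 q y ∈ T.domain := hS ⟨y, hy, rfl⟩
  have := LinearPMap.adjoint_isFormalAdjoint (dense_of_preMinDomain_le hw hS) g ⟨_, hm⟩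
  rwa [apply_eq_tauL2 hT y hm] at this

theorem adjoint_le_maxOp (hw : IsMaxPair q w₁ w₂) {T : L2 →ₗ.[ℂ] L2}
    (hT : T ≤ maxOp q) (hS : preMinDomain q ≤ T.domain) : T.adjoint ≤ maxOp q := by
  refine LinearPMap.le_of_le_graph ?_
  rintro ⟨x, z⟩ h
  obtain ⟨g, h1, h2⟩ := (LinearPMap.mem_graph_iff _).1 h
  obtain ⟨y, hy, hy'⟩ := exists_of_mem_adjoint_domain hw hT hS g
  exact mem_graph_maxOp_iff.2 ⟨y, hy.trans h1, hy'.trans h2⟩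

/-- The adjoint of a restriction of the maximal operator in terms of boundary values. -/
theorem mem_adjoint_domain_iff (hw : IsMaxPair q w₁ w₂) {T : L2 →ₗ.[ℂ] L2}
    (hT : T ≤ maxOp q) (hS : preMinDomain q ≤ T.domain) (g : L2) :
    g ∈ T.adjoint.domain ↔ ∃ y : maxFun q, toL2 q y = g ∧ ∀ f : maxFun q, toL2 q f ∈ T.domain →
      symp (boundary hw f).2 (boundary hw y).2 = symp (boundary hw f).1 (boundary hw y).1 := by
  constructor
  · intro hg
    obtain ⟨y, hy, hy'⟩ := exists_of_mem_adjoint_domain hw hT hS ⟨g, hg⟩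
    refine ⟨y, hy, fun f hf => ?_⟩
    have := LinearPMap.adjoint_isFormalAdjoint (dense_of_preMinDomain_le hw hS) ⟨g, hg⟩ ⟨_, hf⟩
    rw [apply_eq_tauL2 hT f hf, ← hy'] at this
    have h2 := congrArg conj this
    rw [inner_conj_symm, inner_conj_symm, ← hy] at h2
    rw [← sub_eq_zero, ← hw.green, h2, sub_self]
  · rintro ⟨y, rfl, hy⟩
    refine LinearPMap.mem_adjoint_domain_of_exists _ ⟨tauL2 q y, ?_⟩
    rintro ⟨x, hx⟩
    obtain ⟨f, rfl⟩ := hT.1 hx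
    rw [apply_eq_tauL2 hT f hx]
    have := hw.green f y
    rw [hy f hx, sub_self, sub_eq_zero] at this
    have h2 := congrArg conj this
    rw [inner_conj_symm, inner_conj_symm] at h2
    exact h2.symm

/-- The restriction of the maximal operator to the functions with compact support. -/
abbrev preMinOp (q : ℝ → ℝ) : L2 →ₗ.[ℂ] L2 := (maxOp q).domRestrict (preMinDomain q)

theorem preMinOp_le : preMinOp q ≤ maxOp q := LinearPMap.domRestrict_le

theorem preMinDomain_le_preMinOp : preMinDomain q ≤ (preMinOp q).domain := by
  rintro _ ⟨y, hy, rfl⟩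
  exact ⟨⟨y, hy, rfl⟩, y, rfl⟩

/-- Functions of compact support have zero boundary values, so the boundary condition describing the
adjoint is void. -/
theorem adjoint_preMinOp (hw : IsMaxPair q w₁ w₂) : (preMinOp q).adjoint = maxOp q := by
  refine LinearPMap.eq_of_le_of_domain_eq
    (adjoint_le_maxOp hw preMinOp_le preMinDomain_le_preMinOp) ?_
  ext g
  rw [mem_adjoint_domain_iff hw preMinOp_le preMinDomain_le_preMinOp]
  refine exists_congr fun y => and_iff_left fun f hf => ?_
  obtain ⟨⟨z, hz, hzf⟩, -⟩ := hf
  obtain rfl := toL2_injective q hzf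
  simp [boundary_eq_zero_of_hasCompactSupport hw hz, symp]

theorem isClosed_maxOp (hw : IsMaxPair q w₁ w₂) : (maxOp q).IsClosed := by
  rw [← adjoint_preMinOp hw]
  exact LinearPMap.adjoint_isClosed (dense_of_preMinDomain_le hw preMinDomain_le_preMinOp)

theorem graph_minOp (hw : IsMaxPair q w₁ w₂) :
    (minOp q).graph = (preMinOp q).graph.topologicalClosure :=
  ((isClosed_maxOp hw).isClosable.leIsClosable
    preMinOp_le).graph_closure_eq_closure_graph.symm

theorem minOp_le_maxOp (hw : IsMaxPair q w₁ w₂) : minOp q ≤ maxOp q := by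
  refine LinearPMap.le_of_le_graph ?_
  rw [graph_minOp hw]
  exact Submodule.topologicalClosure_minimal _ (LinearPMap.le_graph_of_le preMinOp_le)
    (isClosed_maxOp hw)

theorem preMinDomain_le_minOp : preMinDomain q ≤ (minOp q).domain :=
  preMinDomain_le_preMinOp.trans (LinearPMap.le_closure (preMinOp q)).1

/-- On the graph itself this is Green's formula with zero boundary values, and the condition is
closed. -/
theorem inner_sub_inner_eq_zero_of_mem_closure (hw : IsMaxPair q w₁ w₂) {p : L2 × L2}
    (hp : p ∈ (preMinOp q).graph.topologicalClosure) (f : maxFun q) :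
    inner ℂ (tauL2 q f) p.1 - inner ℂ (toL2 q f) p.2 = 0 := by
  have hc : IsClosed {p : L2 × L2 | inner ℂ (tauL2 q f) p.1 - inner ℂ (toL2 q f) p.2 = 0} :=
    isClosed_eq (by fun_prop) continuous_const
  refine closure_minimal ?_ hc hp
  rintro ⟨x, z⟩ h
  obtain ⟨y', rfl, rfl⟩ := mem_graph_maxOp_iff.1 (LinearPMap.le_graph_of_le preMinOp_le h)
  obtain ⟨⟨y, hy, hyy⟩, -⟩ := LinearPMap.mem_domain_of_mem_graph h
  obtain rfl := toL2_injective q hyy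
  change inner ℂ (tauL2 q f) (toL2 q y) - inner ℂ (toL2 q f) (tauL2 q y) = 0
  rw [hw.green, boundary_eq_zero_of_hasCompactSupport hw hy]
  simp [symp]

/-- The closure is the double orthogonal complement. A vector (v₁, v₂) orthogonal to the graph says
weakly that v₁ = τf with f = -v₂; Green's formula for `f` and `y` then makes it orthogonal to (y,
τy). -/
theorem mem_closure_of_boundary_eq_zero (hw : IsMaxPair q w₁ w₂) {y : maxFun q}
    (hy : boundary hw y = 0) :
    (toL2 q y, tauL2 q y) ∈ (preMinOp q).graph.topologicalClosure := by
  -- Orthogonal complements need the Hilbert norm on the product; the topology is unchanged.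
  set e := WithLp.prodContinuousLinearEquiv 2 ℂ L2 L2
  set K : Submodule ℂ (WithLp 2 (L2 × L2)) := (preMinOp q).graph.comap e.toLinearEquiv.toLinearMap
  have hK : e.symm (toL2 q y, tauL2 q y) ∈ K.topologicalClosure := by
    rw [← Submodule.orthogonal_orthogonal_eq_closure, Submodule.mem_orthogonal]
    intro v hv
    obtain ⟨f, hf, hf'⟩ := hw.exists_of_weak (g := -v.snd) (h := v.fst) fun y' hy' => by
      have hm : e.symm (toL2 q y', tauL2 q y') ∈ K := by
        change (toL2 q y', tauL2 q y') ∈ (preMinOp q).graph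
        have hd : toL2 q y' ∈ (preMinOp q).domain := preMinDomain_le_preMinOp ⟨y', hy', rfl⟩
        rw [← apply_eq_tauL2 preMinOp_le y' hd]
        exact LinearPMap.mem_graph (preMinOp q) ⟨_, hd⟩
      have := Submodule.inner_left_of_mem_orthogonal hm hv
      rw [WithLp.prod_inner_apply] at this
      rw [inner_neg_left]
      exact eq_neg_of_add_eq_zero_left this
    rw [WithLp.prod_inner_apply]
    change inner ℂ v.fst (toL2 q y) + inner ℂ v.snd (tauL2 q y) = 0
    have hg := hw.green f y
    rw [hf, hf', hy, inner_neg_left] at hg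
    simpa [symp] using hg
  have hcl : K.topologicalClosure ≤
      (preMinOp q).graph.topologicalClosure.comap e.toLinearEquiv.toLinearMap :=
    Submodule.topologicalClosure_minimal _
      (Submodule.comap_mono (Submodule.le_topologicalClosure _))
      ((Submodule.isClosed_topologicalClosure _).preimage e.continuous)
  exact hcl hK

/-- The domain of the minimal operator consists of the functions with vanishing boundary values. -/
theorem mem_minOp_domain_iff (hw : IsMaxPair q w₁ w₂) (g : L2) :
    g ∈ (minOp q).domain ↔ ∃ y : maxFun q, toL2 q y = g ∧ boundary hw y = 0 := by
  constructor
  · intro hg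
    obtain ⟨y, rfl⟩ := (minOp_le_maxOp hw).1 hg
    refine ⟨y, rfl, ?_⟩
    have hm := LinearPMap.mem_graph (minOp q) ⟨_, hg⟩
    rw [apply_eq_tauL2 (minOp_le_maxOp hw) y hg, graph_minOp hw] at hm
    -- As `a` and `b` vary independently, both sides must vanish, and `symp` is nondegenerate.
    have key : ∀ a b : Fin 2 → ℂ, symp b (boundary hw y).2 = symp a (boundary hw y).1 := by
      intro a b
      obtain ⟨f, hf⟩ := boundary_surjective hw (a, b)
      have := inner_sub_inner_eq_zero_of_mem_closure hw hm f
      rw [hw.green, hf, sub_eq_zero] at this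
      exact this
    have h0 : ∀ v : Fin 2 → ℂ, (∀ a, symp a v = 0) → v = 0 := fun v hv => by
      have h1 := hv ![1, 0]
      have h2 := hv ![0, 1]
      ext i
      fin_cases i
      · simpa [symp] using h2
      · simpa [symp] using h1
    refine Prod.ext (h0 _ fun a => ?_) (h0 _ fun b => ?_)
    · rw [← key a 0]; simp [symp]
    · rw [key 0 b]; simp [symp]
  · rintro ⟨y, rfl, hy⟩
    have := mem_closure_of_boundary_eq_zero hw hy
    rw [← graph_minOp hw] at this
    exact LinearPMap.mem_domain_of_mem_graph this

/-! ### Bi-extensions and planes of boundary values -/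

theorem IsBiExtension.le_maxOp (hw : IsMaxPair q w₁ w₂) {T : L2 →ₗ.[ℂ] L2}
    (hT : IsBiExtension (minOp q) T) : T ≤ maxOp q :=
  hT.le_adjoint.trans (adjoint_le_maxOp hw (minOp_le_maxOp hw) preMinDomain_le_minOp)

/-- A two-dimensional bi-extension is described by a plane of boundary values. -/
theorem IsTwoDimBiExtension.exists_submodule (hw : IsMaxPair q w₁ w₂) {T : L2 →ₗ.[ℂ] L2}
    (hT : IsTwoDimBiExtension (minOp q) T) : ∃ V : Submodule ℂ BV, Module.finrank ℂ V = 2 ∧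
      ∀ g, g ∈ T.domain ↔ ∃ y : maxFun q, toL2 q y = g ∧ boundary hw y ∈ V := by
  have hle : T ≤ maxOp q := hT.toIsBiExtension.le_maxOp hw
  let ψ : T.domain →ₗ[ℂ] BV := boundary hw ∘ₗ
    (LinearEquiv.ofInjective (toL2 q) (toL2_injective q)).symm.toLinearMap ∘ₗ
    Submodule.inclusion hle.1
  have hψ : ∀ (y : maxFun q) (h : toL2 q y ∈ T.domain), ψ ⟨toL2 q y, h⟩ = boundary hw y := by
    intro y h
    change boundary hw ((LinearEquiv.ofInjective (toL2 q) (toL2_injective q)).symm _) = _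
    congr 1
    exact (LinearEquiv.symm_apply_eq _).2 rfl
  -- Thus the range of ψ is isomorphic to dom T / dom A and has dimension 2.
  have hker : LinearMap.ker ψ = (minOp q).domain.submoduleOf T.domain := by
    ext ⟨x, hx⟩
    obtain ⟨y, rfl⟩ := hle.1 hx
    rw [LinearMap.mem_ker, hψ, Submodule.submoduleOf, Submodule.mem_comap, Submodule.subtype_apply,
      mem_minOp_domain_iff hw]
    constructor
    · exact fun h => ⟨y, rfl, h⟩
    · rintro ⟨z, hz, h⟩
      rwa [← toL2_injective q hz]
  refine ⟨LinearMap.range ψ, ?_, fun g => ⟨fun hg => ?_, ?_⟩⟩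
  · have h2 := hT.finrank_eq
    rw [← hker] at h2
    exact ψ.quotKerEquivRange.finrank_eq.symm.trans h2
  · obtain ⟨y, rfl⟩ := hle.1 hg
    exact ⟨y, rfl, ⟨_, hg⟩, hψ y hg⟩
  · rintro ⟨y, rfl, ⟨x, hx⟩, h⟩
    obtain ⟨z, rfl⟩ := hle.1 hx
    rw [hψ] at h
    -- Equal boundary values mean a difference in dom A, which is contained in dom T.
    have hyz : toL2 q (y - z) ∈ T.domain := by
      refine hT.le.1 ((mem_minOp_domain_iff hw _).2 ⟨_, rfl, ?_⟩)
      rw [map_sub, h, sub_self]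
    simpa using T.domain.add_mem hyz hx

end Operators

/-! ### Parity -/

section Parity

variable {q : ℝ → ℝ} {w₁ w₂ : ℝ → ℂ}

theorem hasDerivAt_comp_neg {y : ℝ → ℂ} (hy : Differentiable ℝ y) (x : ℝ) :
    HasDerivAt (fun x => y (-x)) (-deriv y (-x)) x := by
  rw [← deriv_comp_neg]
  exact (hy.comp differentiable_neg x).hasDerivAt

theorem Regular.comp_neg {y : ℝ → ℂ} (hy : Regular y) : Regular (fun x => y (-x)) :=
  Regular.of_hasDerivAt (hasDerivAt_comp_neg hy.diff)
    (hy.ac_deriv.comp_neg.of_dist_le fun _ _ => (dist_neg_neg _ _).le)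

theorem tau_comp_neg (hq : ∀ x, q x = q (-x)) {y : ℝ → ℂ} (hy : Regular y) :
    tau q (fun x => y (-x)) = tau q y ∘ Neg.neg := by
  have h1 : deriv (fun x => y (-x)) = fun x => -deriv y (-x) :=
    funext fun x => (hasDerivAt_comp_neg hy.diff x).deriv
  ext x
  rw [tau, h1, deriv.fun_neg, deriv_comp_neg, Function.comp_apply, tau, ← hq]
  ring

theorem measurePreserving_neg_volume : MeasurePreserving (Neg.neg : ℝ → ℝ) volume volume :=
  Measure.measurePreserving_neg volume

/-- The reflection `x ↦ y (-x)` on the maximal domain. -/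
def maxFunNeg (hq : ∀ x, q x = q (-x)) (y : maxFun q) : maxFun q :=
  ⟨fun x => (y : ℝ → ℂ) (-x), y.2.1.comp_neg,
    y.2.2.1.comp_measurePreserving measurePreserving_neg_volume, by
      rw [tau_comp_neg hq y.2.1]
      exact y.2.2.2.comp_measurePreserving measurePreserving_neg_volume⟩

theorem parity_toL2 (hq : ∀ x, q x = q (-x)) (y : maxFun q) :
    parity (toL2 q y) = toL2 q (maxFunNeg hq y) :=
  Lp.toLp_compMeasurePreserving y.2.2.1 measurePreserving_neg_volume

theorem parity_parity (f : L2) : parity (parity f) = f := by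
  have h := Lp.compMeasurePreserving_comp_apply (E := ℂ) (p := 2) f measurePreserving_neg_volume
    measurePreserving_neg_volume
  refine h.symm.trans (Lp.ext ?_)
  refine (Lp.coeFn_compMeasurePreserving _ _).trans (ae_of_all _ fun x => ?_)
  simp

/-- The action of parity on boundary values. -/
def reflect (v : Fin 2 → ℂ) : Fin 2 → ℂ := ![v 0, -v 1]

theorem reflect_reflect (v : Fin 2 → ℂ) : reflect (reflect v) = v :=
  funext (Fin.forall_fin_two.2 ⟨rfl, neg_neg (v 1)⟩)

/-- Reflection reverses the derivative. For odd `w₁` this sign is absorbed by the parity of `w₁`;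
for even `w₂` it remains. -/
theorem boundary_maxFunNeg (hw : IsMaxPair q w₁ w₂) (hq : ∀ x, q x = q (-x)) (y : maxFun q) :
    boundary hw (maxFunNeg hq y) = (reflect (boundary hw y).2, reflect (boundary hw y).1) := by
  have d1 : ∀ x, deriv w₁ (-x) = deriv w₁ x := fun x => by
    have h := deriv_comp_neg w₁ x
    rw [funext hw.odd₁, deriv.fun_neg] at h
    exact (neg_injective h).symm
  have d2 : ∀ x, deriv w₂ (-x) = -deriv w₂ x := fun x => by
    have h := deriv_comp_neg w₂ x
    rw [funext hw.even₂] at h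
    rw [h, neg_neg]
  have dy := fun x => (hasDerivAt_comp_neg y.2.1.diff x).deriv
  have b1 : ∀ x, bracket w₁ (maxFunNeg hq y) x = bracket w₁ y (-x) := fun x => by
    rw [hw.bracket_left₁, hw.bracket_left₁, hw.odd₁, d1]
    simp only [maxFunNeg, dy]
    ring
  have b2 : ∀ x, bracket w₂ (maxFunNeg hq y) x = -bracket w₂ y (-x) := fun x => by
    rw [hw.bracket_left₂, hw.bracket_left₂, hw.even₂, d2]
    simp only [maxFunNeg, dy]
    ring
  have e1 : bvBot w₁ (maxFunNeg hq y) = bvTop w₁ y :=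
    tendsto_nhds_unique (tendsto_bvBot ⟨w₁, hw.mem₁⟩ _)
      (((tendsto_bvTop ⟨w₁, hw.mem₁⟩ y).comp tendsto_neg_atBot_atTop).congr fun x => (b1 x).symm)
  have e2 : bvBot w₂ (maxFunNeg hq y) = -bvTop w₂ y :=
    tendsto_nhds_unique (tendsto_bvBot ⟨w₂, hw.mem₂⟩ _)
      (((tendsto_bvTop ⟨w₂, hw.mem₂⟩ y).comp tendsto_neg_atBot_atTop).neg.congr
        fun x => (b2 x).symm)
  have e3 : bvTop w₁ (maxFunNeg hq y) = bvBot w₁ y :=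
    tendsto_nhds_unique (tendsto_bvTop ⟨w₁, hw.mem₁⟩ _)
      (((tendsto_bvBot ⟨w₁, hw.mem₁⟩ y).comp tendsto_neg_atTop_atBot).congr fun x => (b1 x).symm)
  have e4 : bvTop w₂ (maxFunNeg hq y) = -bvBot w₂ y :=
    tendsto_nhds_unique (tendsto_bvTop ⟨w₂, hw.mem₂⟩ _)
      (((tendsto_bvBot ⟨w₂, hw.mem₂⟩ y).comp tendsto_neg_atTop_atBot).neg.congr
        fun x => (b2 x).symm)
  simp only [boundary, LinearMap.coe_mk, AddHom.coe_mk, e1, e2, e3, e4, reflect]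
  rfl

theorem mem_bcDomain_iff (hw : IsMaxPair q w₁ w₂) {C : (Fin 2 → ℂ) → (Fin 2 → ℂ) → Prop} {g : L2} :
    g ∈ bcDomain q w₁ w₂ C ↔
      ∃ y : maxFun q, toL2 q y = g ∧ C (boundary hw y).1 (boundary hw y).2 :=
  Iff.rfl

theorem parity_mem_bcDomain_iff (hw : IsMaxPair q w₁ w₂) (hq : ∀ x, q x = q (-x))
    {C C' : (Fin 2 → ℂ) → (Fin 2 → ℂ) → Prop} (h : ∀ a b, C' a b ↔ C (reflect b) (reflect a))
    {g : L2} : parity g ∈ bcDomain q w₁ w₂ C ↔ g ∈ bcDomain q w₁ w₂ C' := by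
  rw [mem_bcDomain_iff hw, mem_bcDomain_iff hw]
  constructor
  · rintro ⟨y, hy, hC⟩
    refine ⟨maxFunNeg hq y, ?_, ?_⟩
    · rw [← parity_toL2, hy, parity_parity]
    · rw [h, boundary_maxFunNeg]
      simpa only [reflect_reflect] using hC
  · rintro ⟨y, rfl, hC⟩
    refine ⟨maxFunNeg hq y, (parity_toL2 hq y).symm, ?_⟩
    rw [boundary_maxFunNeg]
    exact (h _ _).1 hC

theorem kreinAdjoint_domain (T : L2 →ₗ.[ℂ] L2) :
    (kreinAdjoint T).domain = T.adjoint.domain.map parity := by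
  ext g
  change parity g ∈ T.adjoint.domain ↔ _
  rw [Submodule.mem_map]
  exact ⟨fun h => ⟨_, h, parity_parity g⟩, by rintro ⟨f, hf, rfl⟩; rwa [parity_parity]⟩

/-- The adjoint and the Krein space adjoint of a restriction of the maximal operator which is given
by boundary conditions. -/
theorem adjoint_domain_eq_bcDomain (hw : IsMaxPair q w₁ w₂) (hq : ∀ x, q x = q (-x))
    {T : L2 →ₗ.[ℂ] L2} (hT : T ≤ maxOp q) {C C' C'' : (Fin 2 → ℂ) → (Fin 2 → ℂ) → Prop}
    (hC : (T.domain : Set L2) = bcDomain q w₁ w₂ C) (h0 : C 0 0)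
    (h' : ∀ a' b', C' a' b' ↔ ∀ a b, C a b → symp b b' = symp a a')
    (h'' : ∀ a b, C'' a b ↔ C' (reflect b) (reflect a)) :
    (T.adjoint.domain : Set L2) = bcDomain q w₁ w₂ C' ∧
      ((kreinAdjoint T).domain : Set L2) = bcDomain q w₁ w₂ C'' := by
  have hm : ∀ g, g ∈ T.domain ↔ g ∈ bcDomain q w₁ w₂ C := fun g => by
    rw [← hC, SetLike.mem_coe]
  -- This makes the domain dense, without which the adjoint would not be meaningful.
  have hS : preMinDomain q ≤ T.domain := by
    rintro _ ⟨y, hy, rfl⟩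
    rw [hm, mem_bcDomain_iff hw]
    refine ⟨y, rfl, ?_⟩
    rw [boundary_eq_zero_of_hasCompactSupport hw hy]
    exact h0
  have key : (T.adjoint.domain : Set L2) = bcDomain q w₁ w₂ C' := by
    ext g
    rw [SetLike.mem_coe, mem_adjoint_domain_iff hw hT hS, mem_bcDomain_iff hw]
    refine exists_congr fun y => and_congr_right fun _ => ?_
    rw [h']
    constructor
    · intro H a b hab
      -- Surjectivity turns a condition on functions in the domain into one on all vectors
      -- satisfying `C`.
      obtain ⟨f, hf⟩ := boundary_surjective hw (a, b)
      have := H f ((hm _).2 ((mem_bcDomain_iff hw).2 ⟨f, rfl, by rwa [hf]⟩))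
      rwa [hf] at this
    · intro H f hf
      obtain ⟨z, hz, hz'⟩ := (mem_bcDomain_iff hw).1 ((hm _).1 hf)
      obtain rfl := toL2_injective q hz
      exact H _ _ hz'
  refine ⟨key, ?_⟩
  ext g
  rw [← parity_mem_bcDomain_iff hw hq h'', ← key]
  rfl

end Parity

/-! ### Boundary conditions -/

/-- The condition on `u` defines the line spanned by (sin θ, ξ cos θ). Pairing that vector with `v`
and multiplying by `-ξ` gives the condition on `v`. -/
theorem symp_eq_zero_iff_separated {ξ : ℂ} (hξ : ‖ξ‖ = 1) (θ : ℝ) (v : Fin 2 → ℂ) :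
    (Real.cos θ : ℂ) * v 0 + -(ξ * Real.sin θ) * v 1 = 0 ↔
      ∀ u : Fin 2 → ℂ, ξ * Real.cos θ * u 0 + -(Real.sin θ : ℂ) * u 1 = 0 → symp u v = 0 := by
  have h1 : ξ * conj ξ = 1 := by
    rw [Complex.mul_conj, Complex.normSq_eq_norm_sq, hξ]; simp
  have h2 : (Real.sin θ : ℂ) ^ 2 + (Real.cos θ : ℂ) ^ 2 = 1 := by
    exact_mod_cast Real.sin_sq_add_cos_sq θ
  constructor
  · intro hv u hu
    have hu' := congrArg conj hu
    simp only [map_add, map_mul, map_neg, Complex.conj_ofReal, map_zero] at hu'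
    rw [symp]
    linear_combination (-(conj (u 0) * v 1 - conj (u 1) * v 0)) * h2 +
      (Real.sin θ : ℂ) * (v 0 * hu' - conj ξ * conj (u 0) * hv
        - (Real.sin θ : ℂ) * conj (u 0) * v 1 * h1) +
      (Real.cos θ : ℂ) * (ξ * v 1 * hu' - conj (u 1) * hv
        - (Real.cos θ : ℂ) * conj (u 0) * v 1 * h1)
  · intro H
    have := H ![Real.sin θ, ξ * Real.cos θ] (by simp; ring)
    simp only [symp, Matrix.cons_val_zero, Matrix.cons_val_one, map_mul, Complex.conj_ofReal] at this
    linear_combination (-ξ) * this + (Real.cos θ : ℂ) * v 0 * (-h1)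

/-- The matrix with conjugated entries is the adjoint of `!![a, b; c, d]` for the nondegenerate form
`symp`. -/
theorem eq_mulVec_iff_forall_symp (a b c d : ℂ) (u v : Fin 2 → ℂ) :
    u = (!![conj d, -conj b; -conj c, conj a]).mulVec v ↔
      ∀ x, symp ((!![a, b; c, d]).mulVec x) v = symp x u := by
  have e : ∀ x, symp ((!![a, b; c, d]).mulVec x) v =
      symp x ((!![conj d, -conj b; -conj c, conj a]).mulVec v) := fun x => by
    simp [symp, Matrix.mulVec, dotProduct, Fin.sum_univ_two]; ring
  constructor
  · rintro rfl x
    exact e x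
  · intro H
    have h1 := (e ![1, 0]).symm.trans (H _)
    have h2 := (e ![0, 1]).symm.trans (H _)
    simp only [symp, Matrix.cons_val_zero, Matrix.cons_val_one, map_one, map_zero] at h1 h2
    refine funext (Fin.forall_fin_two.2 ⟨?_, ?_⟩)
    · linear_combination h2
    · linear_combination -h1

/-- Conjugation by diag(1, -1) changes the sign of the off-diagonal entries. -/
theorem eq_mulVec_iff_reflect (a b c d : ℂ) (u v : Fin 2 → ℂ) :
    u = (!![a, b; c, d]).mulVec v ↔
      reflect u = (!![a, -b; -c, d]).mulVec (reflect v) := by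
  have h : (!![a, -b; -c, d]).mulVec (reflect v) = reflect ((!![a, b; c, d]).mulVec v) := by
    refine funext (Fin.forall_fin_two.2 ⟨?_, ?_⟩) <;>
      simp [reflect, Matrix.mulVec, dotProduct, Fin.sum_univ_two]
    ring
  rw [h]
  exact (Function.LeftInverse.injective reflect_reflect).eq_iff.symm

/-! ### Normal forms of lines and planes of boundary values -/

theorem exists_normalized_separated {u : Fin 2 → ℂ} (hu : u ≠ 0) :
    ∃ (ξ : ℂ) (θ : ℝ), ‖ξ‖ = 1 ∧ θ ∈ Set.Ico 0 (2 * Real.pi) ∧ ∀ a : Fin 2 → ℂ,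
      a ∈ Submodule.span ℂ {u} ↔ ξ * Real.cos θ * a 0 + -(Real.sin θ : ℂ) * a 1 = 0 := by
  have hpi := Real.pi_pos
  by_cases h0 : u 0 = 0
  · have h1 : u 1 ≠ 0 := fun h1 => hu (by ext i; fin_cases i <;> assumption)
    refine ⟨1, 0, by simp, ⟨le_rfl, by positivity⟩, fun a => ?_⟩
    rw [Submodule.mem_span_singleton]
    simp only [Real.cos_zero, Real.sin_zero, Complex.ofReal_one, Complex.ofReal_zero, mul_one,
      one_mul, neg_zero, zero_mul, add_zero]
    constructor
    · rintro ⟨c, rfl⟩; simp [h0]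
    · intro ha
      refine ⟨a 1 / u 1, ?_⟩
      ext i; fin_cases i
      · simp [h0, ha]
      · simp [h1]
  -- The line has slope `r`, written as ξ|r|. The condition has slope ξ cot θ, so θ = π/2 - arctan
  -- |r|; the vertical line was θ = 0.
  · set r := u 1 / u 0
    obtain ⟨ξ, hξ, hr⟩ : ∃ ξ : ℂ, ‖ξ‖ = 1 ∧ ξ * ‖r‖ = r := by
      by_cases hr : r = 0
      · exact ⟨1, by simp, by simp [hr]⟩
      · have : (‖r‖ : ℂ) ≠ 0 := by exact_mod_cast norm_ne_zero_iff.2 hr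
        exact ⟨r / ‖r‖, by simp [hr], by field_simp⟩
    have hc := Real.cos_arctan_pos ‖r‖
    have hs : Real.sin (Real.arctan ‖r‖) = ‖r‖ * Real.cos (Real.arctan ‖r‖) := by
      conv_rhs => rw [← Real.tan_arctan ‖r‖, Real.arctan_tan (Real.neg_pi_div_two_lt_arctan _)
        (Real.arctan_lt_pi_div_two _), Real.tan_mul_cos hc.ne']
    have hlt := Real.arctan_lt_pi_div_two ‖r‖
    have hnn : 0 ≤ Real.arctan ‖r‖ := Real.arctan_nonneg.2 (norm_nonneg _)
    refine ⟨ξ, Real.pi / 2 - Real.arctan ‖r‖, hξ, ⟨by linarith, by linarith⟩, fun a => ?_⟩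
    rw [Submodule.mem_span_singleton, Real.cos_pi_div_two_sub, Real.sin_pi_div_two_sub, hs]
    have hcc : (Real.cos (Real.arctan ‖r‖) : ℂ) ≠ 0 := by exact_mod_cast hc.ne'
    have e : ξ * ((‖r‖ * Real.cos (Real.arctan ‖r‖) : ℝ) : ℂ) * a 0 +
        -(Real.cos (Real.arctan ‖r‖) : ℂ) * a 1 =
        (Real.cos (Real.arctan ‖r‖) : ℂ) * (r * a 0 - a 1) := by
      rw [Complex.ofReal_mul]
      linear_combination (Real.cos (Real.arctan ‖r‖) : ℂ) * a 0 * hr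
    rw [e, mul_eq_zero, or_iff_right hcc]
    constructor
    · rintro ⟨c, rfl⟩
      simp only [Pi.smul_apply, smul_eq_mul, r]
      field_simp
      ring
    · intro ha
      refine ⟨a 0 / u 0, ?_⟩
      ext i; fin_cases i
      · simp [h0]
      · simp only [r] at ha
        simp only [Fin.mk_one, Pi.smul_apply, smul_eq_mul]
        linear_combination ha

/-- By dimension, `p` maps `V` isomorphically onto ℂ², so `V` is the graph of `p'` composed with the
inverse. -/
theorem exists_matrix_of_injective {V : Submodule ℂ BV} (hV : Module.finrank ℂ V = 2)
    (p p' : BV →ₗ[ℂ] (Fin 2 → ℂ)) (hp : ∀ x ∈ V, p x = 0 → x = 0)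
    (hpp : ∀ x y, p x = p y → p' x = p' y → x = y) :
    ∃ M : Matrix (Fin 2) (Fin 2) ℂ, ∀ x, x ∈ V ↔ p' x = M.mulVec (p x) := by
  have hinj : Function.Injective (p.domRestrict V) := by
    rw [← LinearMap.ker_eq_bot, Submodule.eq_bot_iff]
    rintro ⟨x, hx⟩ h
    exact Subtype.ext (hp x hx h)
  let e := LinearEquiv.ofInjectiveOfFinrankEq (p.domRestrict V) hinj (by simp [hV])
  have he : ∀ x (hx : x ∈ V), e ⟨x, hx⟩ = p x := fun _ _ => rfl
  refine ⟨LinearMap.toMatrix' (p'.domRestrict V ∘ₗ e.symm.toLinearMap), fun x => ?_⟩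
  rw [LinearMap.toMatrix'_mulVec]
  constructor
  · intro hx
    rw [← he x hx]
    simp
  · intro h
    have : x = (e.symm (p x) : V) := by
      refine hpp _ _ ?_ h
      rw [← he _ (e.symm (p x)).2]
      simp
    rw [this]
    exact (e.symm (p x)).2

/-- The planes of boundary values. -/
theorem boundary_plane_cases {V : Submodule ℂ BV} (hV : Module.finrank ℂ V = 2) :
    (∃ u v : Fin 2 → ℂ, u ≠ 0 ∧ v ≠ 0 ∧
      ∀ x : BV, x ∈ V ↔ x.1 ∈ Submodule.span ℂ {u} ∧ x.2 ∈ Submodule.span ℂ {v}) ∨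
    (∃ M : Matrix (Fin 2) (Fin 2) ℂ, ∀ x : BV, x ∈ V ↔ x.2 = M.mulVec x.1) ∨
    (∃ M : Matrix (Fin 2) (Fin 2) ℂ, ∀ x : BV, x ∈ V ↔ x.1 = M.mulVec x.2) := by
  by_cases h1 : ∀ x ∈ V, x.1 = 0 → x = 0
  · exact Or.inr (Or.inl (exists_matrix_of_injective hV (LinearMap.fst ℂ _ _) (LinearMap.snd ℂ _ _)
      h1 fun x y h h' => Prod.ext h h'))
  by_cases h2 : ∀ x ∈ V, x.2 = 0 → x = 0
  · exact Or.inr (Or.inr (exists_matrix_of_injective hV (LinearMap.snd ℂ _ _) (LinearMap.fst ℂ _ _)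
      h2 fun x y h h' => Prod.ext h' h))
  left
  push Not at h1 h2
  -- Neither projection is injective on `V`, so `V` contains some (0, v) and (u, 0) with nonzero
  -- `u`, `v`; the product of the two lines then fills `V` by dimension.
  obtain ⟨⟨a, v⟩, hv, rfl, hv0⟩ := h1
  obtain ⟨⟨u, b⟩, hu, rfl, hu0⟩ := h2
  have hv' : v ≠ 0 := fun h => hv0 (by rw [h]; rfl)
  have hu' : u ≠ 0 := fun h => hu0 (by rw [h]; rfl)
  refine ⟨u, v, hu', hv', ?_⟩
  have hle : (Submodule.span ℂ {u}).prod (Submodule.span ℂ {v}) ≤ V := by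
    rintro ⟨x, y⟩ ⟨hx, hy⟩
    obtain ⟨c, rfl⟩ := Submodule.mem_span_singleton.1 hx
    obtain ⟨d, rfl⟩ := Submodule.mem_span_singleton.1 hy
    simpa using V.add_mem (V.smul_mem c hu) (V.smul_mem d hv)
  have heq := Submodule.eq_of_le_of_finrank_eq hle (by
    let e : (Submodule.span ℂ {u}).prod (Submodule.span ℂ {v}) ≃ₗ[ℂ]
        Submodule.span ℂ {u} × Submodule.span ℂ {v} :=
      { toFun := fun x => (⟨x.1.1, x.2.1⟩, ⟨x.1.2, x.2.2⟩)
        map_add' := fun _ _ => rfl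
        map_smul' := fun _ _ => rfl
        invFun := fun y => ⟨(y.1, y.2), y.1.2, y.2.2⟩
        left_inv := fun _ => rfl
        right_inv := fun _ => rfl }
    rw [hV, e.finrank_eq, Module.finrank_prod,
      finrank_span_singleton hu', finrank_span_singleton hv'])
  intro x
  rw [← heq]
  rfl

end LimitCircle

end

/-! ### Classification and adjoints for the three kinds of boundary conditions -/

open LimitCircle in
theorem mainTheorem8 (q : ℝ → ℝ) (hq : LocallyIntegrable q volume)
    (hq_even : ∀ x, q x = q (-x))
    (hTop : IsLimitCircleTop q) (hBot : IsLimitCircleBot q)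
    (w₁ w₂ : ℝ → ℂ) (hw : IsReferencePair q w₁ w₂) :
    -- every two-dimensional bi-extension is of one of the three types treated below
    (∀ T : L2 →ₗ.[ℂ] L2, IsTwoDimBiExtension (minOp q) T →
      (∃ (ξ η : ℂ) (a b : ℝ), ‖ξ‖ = 1 ∧ ‖η‖ = 1 ∧
        a ∈ Set.Ico 0 (2 * Real.pi) ∧ b ∈ Set.Ico 0 (2 * Real.pi) ∧
        (T.domain : Set L2) = normalizedSeparatedDomain q w₁ w₂ ξ η a b) ∨
      (∃ a b c d : ℂ, (T.domain : Set L2) = betaOfAlphaDomain q w₁ w₂ !![a, b; c, d]) ∨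
      (∃ a b c d : ℂ, (T.domain : Set L2) = alphaOfBetaDomain q w₁ w₂ !![a, b; c, d])) ∧
    -- the domain of the Krein space adjoint is the reflection of the domain of the adjoint
    (∀ T : L2 →ₗ.[ℂ] L2, T ≤ maxOp q →
      (kreinAdjoint T).domain = T.adjoint.domain.map parity) ∧
    -- separated boundary conditions
    (∀ T : L2 →ₗ.[ℂ] L2, T ≤ maxOp q → ∀ (ξ η : ℂ) (a b : ℝ), ‖ξ‖ = 1 → ‖η‖ = 1 →
      (T.domain : Set L2) = normalizedSeparatedDomain q w₁ w₂ ξ η a b →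
      (T.adjoint.domain : Set L2) = separatedDomain q w₁ w₂
        (Real.cos a) (-(ξ * Real.sin a)) (Real.cos b) (-(η * Real.sin b)) ∧
      ((kreinAdjoint T).domain : Set L2) = separatedDomain q w₁ w₂
        (Real.cos b) (η * Real.sin b) (Real.cos a) (ξ * Real.sin a)) ∧
    -- mixed boundary conditions expressing the values at `+∞` through those at `-∞`
    (∀ T : L2 →ₗ.[ℂ] L2, T ≤ maxOp q → ∀ a b c d : ℂ,
      (T.domain : Set L2) = betaOfAlphaDomain q w₁ w₂ !![a, b; c, d] →
      (T.adjoint.domain : Set L2) =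
        alphaOfBetaDomain q w₁ w₂ !![conj d, -conj b; -conj c, conj a] ∧
      ((kreinAdjoint T).domain : Set L2) =
        betaOfAlphaDomain q w₁ w₂ !![conj d, conj b; conj c, conj a]) ∧
    -- mixed boundary conditions expressing the values at `-∞` through those at `+∞`
    (∀ T : L2 →ₗ.[ℂ] L2, T ≤ maxOp q → ∀ a b c d : ℂ,
      (T.domain : Set L2) = alphaOfBetaDomain q w₁ w₂ !![a, b; c, d] →
      (T.adjoint.domain : Set L2) =
        betaOfAlphaDomain q w₁ w₂ !![conj d, -conj b; -conj c, conj a] ∧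
      ((kreinAdjoint T).domain : Set L2) =
        alphaOfBetaDomain q w₁ w₂ !![conj d, conj b; conj c, conj a]) := by
  have hm : IsMaxPair q w₁ w₂ :=
    ⟨hw, hw.sol₁.mem_maxFun hTop hBot, hw.sol₂.mem_maxFun hTop hBot⟩
  refine ⟨fun T hT => ?_, fun T _ => kreinAdjoint_domain T, ?_, ?_, ?_⟩
  · obtain ⟨V, hV, hTV⟩ := hT.exists_submodule hm
    rcases boundary_plane_cases hV with ⟨u, v, hu, hv, h⟩ | ⟨M, h⟩ | ⟨M, h⟩
    · left
      obtain ⟨ξ, θ, hξ, hθ, h1⟩ := exists_normalized_separated hu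
      obtain ⟨η, φ, hη, hφ, h2⟩ := exists_normalized_separated hv
      refine ⟨ξ, η, θ, φ, hξ, hη, hθ, hφ, ?_⟩
      ext g
      rw [SetLike.mem_coe, hTV, normalizedSeparatedDomain, separatedDomain, mem_bcDomain_iff hm]
      simp only [h, h1, h2]
    · right; left
      refine ⟨M 0 0, M 0 1, M 1 0, M 1 1, ?_⟩
      ext g
      rw [SetLike.mem_coe, hTV, betaOfAlphaDomain, mem_bcDomain_iff hm, ← Matrix.eta_fin_two M]
      simp only [h]
    · right; right
      refine ⟨M 0 0, M 0 1, M 1 0, M 1 1, ?_⟩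
      ext g
      rw [SetLike.mem_coe, hTV, alphaOfBetaDomain, mem_bcDomain_iff hm, ← Matrix.eta_fin_two M]
      simp only [h]
  · intro T hT ξ η a b hξ hη hdom
    rw [normalizedSeparatedDomain, separatedDomain] at hdom
    refine adjoint_domain_eq_bcDomain hm hq_even hT hdom (by simp) (fun a' b' => ?_)
      (fun a' b' => ?_)
    · rw [symp_eq_zero_iff_separated hξ, symp_eq_zero_iff_separated hη]
      constructor
      · rintro ⟨h1, h2⟩ x y ⟨hx, hy⟩
        rw [h1 x hx, h2 y hy]
      · intro H
        -- The conditions at the two ends are independent, so setting the values at one end to zero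
        -- isolates the other.
        refine ⟨fun x hx => ?_, fun y hy => ?_⟩
        · rw [← H x 0 ⟨hx, by simp⟩]; simp [symp]
        · rw [H 0 y ⟨by simp, hy⟩]; simp [symp]
    · simp only [reflect, Matrix.cons_val_zero, Matrix.cons_val_one, neg_mul_neg]
      exact and_comm
  · intro T hT a b c d hdom
    refine adjoint_domain_eq_bcDomain hm hq_even hT hdom (by simp) (fun a' b' => ?_)
      (fun a' b' => ?_)
    · rw [eq_mulVec_iff_forall_symp]
      exact ⟨fun H x y h => h ▸ H x, fun H x => H x _ rfl⟩
    · exact eq_mulVec_iff_reflect _ _ _ _ _ _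
  · intro T hT a b c d hdom
    refine adjoint_domain_eq_bcDomain hm hq_even hT hdom (by simp) (fun a' b' => ?_)
      (fun a' b' => ?_)
    · rw [eq_mulVec_iff_forall_symp]
      exact ⟨fun H x y h => h ▸ (H y).symm, fun H y => (H _ y rfl).symm⟩
    · exact eq_mulVec_iff_reflect _ _ _ _ _ _
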